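/- Conventions. A (finite-valued) Young function is a convex even function $\Phi:\mathbb R\to[0,\infty)$ with $\Phi(0)=0$ and $\Phi(x)\to\infty$ as $x\to\infty$. It is an $N$-function if moreover it is continuous, $\Phi(x)=0\Leftrightarrow x=0$, $\Phi(x)/x\to\infty$ as $x\to\infty$ and $\Phi(x)/x\to0$ as $x\to0^+$. Its conjugate is $\Phi^*(y)=\sup_{x\ge0}\{x|y|-\Phi(x)\}$. Inverse functions are those of increasing functions on $[0,\infty)$: $g^{-1}(y)=\inf\{x\ge 0: g(x)\ge y\}$. For a probability measure $\mu$, $\mu(f)=\int f\,d\mu$, $\operatorname{Var}_\mu(f)=\mu((f-\mu(f))^2)$, $L_\Phi(\mu)$ is the set of measurable $f$ with $\int\Phi(\alpha f)\,d\mu<\infty$ for some $\alpha>0$, and $\|f\|_\Phi=\inf\{c>0:\int\Phi(f/c)\,d\mu\le1\}$ is the Luxemburg norm. Let $\psi:[0,\infty)\to[0,\infty)$ be strictly increasing with $\psi(0)=0$ and $\lim_{+\infty}\psi=+\infty$, and assume that $\Phi$ and $\Psi(x)=x^2/\psi(|x|)$ (with $\Psi(0)=0$) are $N$-functions. Let $\theta=(\Phi^*)^{-1}\circ\Psi\circ\psi^{-1}$,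 and let $\mu$ be a (Borel) probability measure on $\mathbb R^n$. Assume that (i) $x\mapsto\Psi(\psi^{-1}(x^2))$ is a Young function; (ii) $\lambda>0$ is such that $\theta(x/16)\ge\lambda\,\theta(x)$ for all $x\ge0$; (iii) $\lambda'\ge4$ is such that $(\Phi^*)^{-1}(\lambda'x)\le\frac{\lambda'}{4}(\Phi^*)^{-1}(x)$ for all $x\ge2$; (iv) $C$ is a constant such that, for every $C^\infty$ function $f:\mathbb R^n\to\mathbb R$ with $f\in L^2(\mu)$ and $\int|\nabla f|^2d\mu<\infty$, $$\operatorname{Var}_\mu(f)\;\theta\!\left(\frac12\,\frac{\operatorname{Var}_\mu(f)}{\|f-\mu(f)\|_\Psi^2}\right)\le C\int|\nabla f|^2\,d\mu$$ (the left-hand side being $0$ if $f$ is $\mu$-a.e. constant); (v) $k\in(0,\infty)$ is such that $\|\mu(f)^2\|_\Phi\le k\,\|f^2\|_\Phi$ for every measurable $f$ with $f^2\in L_\Phi(\mu)$. Then every locally Lipschitz $f:\mathbb R^n\to\mathbb R$ that is differentiable at $\mu$-almost every point and satisfies $\int|\nabla f|^2d\mu<\infty$ (in particular every $C^\infty$ function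 with $\int|\nabla f|^2d\mu<\infty$ and, if $\mu$ is absolutely continuous, every locally Lipschitz function with $\int|\nabla f|^2d\mu<\infty$) is $\mu$-integrable, $(f-\mu(f))^2$ belongs to $L_\Phi(\mu)$, and $$\left\|(f-\mu(f))^2\right\|_\Phi\le\frac{64(1+k)\lambda'}{\lambda^2}\,C\int|\nabla f|^2\,d\mu .$$ -/

import Mathlib

open MeasureTheory Set Filter Topology
open scoped ContDiff

noncomputable section

/-- Finite-valued Young functions. Nonnegativity follows from the fields. -/
structure IsYoungFunction (Φ : ℝ → ℝ) : Prop where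
  convex : ConvexOn ℝ univ Φ
  even : ∀ x, Φ (-x) = Φ x
  zero : Φ 0 = 0
  tendsto_atTop : Tendsto Φ atTop atTop

/-- N-functions: continuous finite-valued Young functions, vanishing only at `0`, superlinear at
infinity and with right derivative `0` at `0`. -/
structure IsNFunction (Φ : ℝ → ℝ) : Prop extends IsYoungFunction Φ where
  continuous : Continuous Φ
  eq_zero_iff : ∀ x, Φ x = 0 ↔ x = 0
  superlinear : Tendsto (fun x => Φ x / x) atTop atTop
  deriv_zero : Tendsto (fun x => Φ x / x) (𝓝[>] 0) (𝓝 0)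

/-- The complementary function `Φ*(y) = sup_{x ≥ 0} (x |y| - Φ x)`. The supremum is finite when
`Φ` is superlinear at infinity. -/
def youngConj (Φ : ℝ → ℝ) (y : ℝ) : ℝ :=
  sSup ((fun x => x * |y| - Φ x) '' Ici 0)

/-- The inverse of an increasing function on `[0, ∞)`: `g⁻¹(y) = inf {x ≥ 0 | y ≤ g x}`. If `g` is
an increasing bijection of `[0, ∞)`, this is its inverse map on `[0, ∞)`. -/
def rInv (g : ℝ → ℝ) (y : ℝ) : ℝ :=
  sInf {x | 0 ≤ x ∧ y ≤ g x}

/-- The function `Ψ(x) = x² / ψ(|x|)` (with value `0` at `x = 0`). -/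
def quotSq (ψ : ℝ → ℝ) (x : ℝ) : ℝ :=
  x ^ 2 / ψ |x|

/-- The function `θ = (Φ*)⁻¹ ∘ Ψ ∘ ψ⁻¹` with `Ψ(x) = x² / ψ(|x|)`. -/
def nashTheta (Φ ψ : ℝ → ℝ) (x : ℝ) : ℝ :=
  rInv (youngConj Φ) (quotSq ψ (rInv ψ x))

/-- Membership in the Orlicz space `L_Φ(μ)`. -/
def MemOrlicz {X : Type*} [MeasurableSpace X] (Φ : ℝ → ℝ) (μ : Measure X) (f : X → ℝ) : Prop :=
  Measurable f ∧ ∃ α : ℝ, 0 < α ∧ ∫⁻ x, ENNReal.ofReal (Φ (α * f x)) ∂μ < ⊤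

/-- The Luxemburg norm of `f`; it is meaningful for `f` in the Orlicz space. -/
def luxNorm {X : Type*} [MeasurableSpace X] (Φ : ℝ → ℝ) (μ : Measure X) (f : X → ℝ) : ℝ :=
  sInf {c | 0 < c ∧ ∫⁻ x, ENNReal.ofReal (Φ (f x / c)) ∂μ ≤ 1}

end

/-! The Nash-type inequality is equivalent in spirit to a Faber–Krahn inequality, and the latter
sums over level sets to an Orlicz–Sobolev inequality. Write `R` for the inverse of the conjugate of
`Φ`.

From Nash to Faber–Krahn: let `h` live on a set of measure at most `M ≤ 1/2`, and choose `y` with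
`Ψ(y) = 1/M`. By Cauchy–Schwarz the variance of `h` is at least half of `∫ h²`, and `luxLe_quotSq`
gives `‖h‖_Ψ² ≤ 4 ∫ h² / ψ(y)`. The argument of `θ` is therefore at least a fixed fraction of
`ψ(y)`. Using the hypothesis on `θ` twice recovers `λ² θ(ψ(y)) = λ² R(1/M)`, so `λ² R(1/M) ∫ h² ≤ 2
C ∫ |∇h|²`. This is `NashIneq.faberKrahn`.

From Faber–Krahn to Sobolev: around a median, the positive and negative parts of `f` are cut at
geometric levels `t_j`. Let `M_j` be the measure of the part above `t_j`. Since `‖1_A‖_Φ ≤ μ(A)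
R(1/μ(A))` (`LuxLe.indicator`), the norm of `(f - m)²` is controlled by `∑ t_j² M_j R(1/M_j)`.
Faber–Krahn on each slice bounds `t_j² M_{j+1} R(1/M_j)` by the energy of that slice. The growth
condition on `R` turns this into a recursion with contraction factor `9/16`
(`IsNFunction.conjInv_level_le`, `NashIneq.sum_levels_le`). The slice energies telescope.

Replacing the median by the mean costs `2(1 + k)`. As `μ` may be singular, all approximations must
control derivatives at every point of differentiability, not just Lebesgue almost everywhere. -/

/-! ### Young functions, N-functions, conjugates and generalized inverses -/

namespace IsYoungFunction

variable {Φ : ℝ → ℝ}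

lemma nonneg (h : IsYoungFunction Φ) (x : ℝ) : 0 ≤ Φ x := by
  have := h.convex.2 (mem_univ x) (mem_univ (-x)) one_half_pos.le one_half_pos.le (add_halves 1)
  rw [h.even x] at this
  have h0 : (1 / 2 : ℝ) • x + (1 / 2 : ℝ) • (-x) = 0 := by simp
  rw [h0, h.zero, smul_eq_mul] at this
  linarith

lemma map_mul_le (h : IsYoungFunction Φ) {a : ℝ} (ha : 0 ≤ a) (ha1 : a ≤ 1) (x : ℝ) :
    Φ (a * x) ≤ a * Φ x := by
  have := h.convex.2 (mem_univ x) (mem_univ 0) ha (sub_nonneg.2 ha1) (by ring)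
  simpa [h.zero] using this

lemma monotoneOn (h : IsYoungFunction Φ) : MonotoneOn Φ (Ici 0) := by
  intro x hx y hy hxy
  rcases eq_or_lt_of_le (mem_Ici.1 hy) with h0 | h0
  · have : x = y := le_antisymm hxy (h0 ▸ hx)
    rw [this]
  · have h1 : x / y ≤ 1 := (div_le_one h0).2 hxy
    have := h.map_mul_le (div_nonneg hx h0.le) h1 y
    rw [div_mul_cancel₀ _ h0.ne'] at this
    exact this.trans (mul_le_of_le_one_left (h.nonneg y) h1)

lemma map_abs (h : IsYoungFunction Φ) (x : ℝ) : Φ |x| = Φ x := by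
  rcases abs_choice x with h' | h' <;> rw [h']
  exact h.even x

lemma le_of_abs_le (h : IsYoungFunction Φ) {x y : ℝ} (hxy : |x| ≤ y) : Φ x ≤ Φ y := by
  rw [← h.map_abs x]
  exact h.monotoneOn (abs_nonneg x) ((abs_nonneg x).trans hxy) hxy

end IsYoungFunction

namespace IsNFunction

variable {Φ : ℝ → ℝ}

lemma exists_mul_le (h : IsNFunction Φ) (K : ℝ) : ∃ M : ℝ, 0 < M ∧ ∀ x, M ≤ x → K * x ≤ Φ x := by
  obtain ⟨M, hM⟩ := eventually_atTop.1 (h.superlinear.eventually_ge_atTop K)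
  refine ⟨max M 1, by positivity, fun x hx => ?_⟩
  have hx0 : 0 < x := lt_of_lt_of_le one_pos ((le_max_right _ _).trans hx)
  exact (le_div_iff₀ hx0).1 (hM x ((le_max_left _ _).trans hx))

lemma conj_aux (h : IsNFunction Φ) {K M y : ℝ} (hM0 : 0 < M) (hM : ∀ x, M ≤ x → K * x ≤ Φ x)
    (hy : |y| ≤ K) {x : ℝ} (hx : 0 ≤ x) : x * |y| - Φ x ≤ M * |y| := by
  rcases le_total M x with h1 | h1
  · have := hM x h1
    nlinarith [mul_le_mul_of_nonneg_left hy hx, mul_nonneg hM0.le (abs_nonneg y)]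
  · nlinarith [h.nonneg x, mul_le_mul_of_nonneg_right h1 (abs_nonneg y)]

lemma conj_bddAbove (h : IsNFunction Φ) (y : ℝ) :
    BddAbove ((fun x => x * |y| - Φ x) '' Ici 0) := by
  obtain ⟨M, hM0, hM⟩ := h.exists_mul_le |y|
  refine ⟨M * |y|, ?_⟩
  rintro _ ⟨x, hx, rfl⟩
  exact h.conj_aux hM0 hM le_rfl hx

lemma le_conj (h : IsNFunction Φ) {x : ℝ} (hx : 0 ≤ x) (y : ℝ) :
    x * |y| - Φ x ≤ youngConj Φ y :=
  le_csSup (h.conj_bddAbove y) ⟨x, hx, rfl⟩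

lemma conj_le {y b : ℝ} (hb : ∀ x, 0 ≤ x → x * |y| - Φ x ≤ b) : youngConj Φ y ≤ b := by
  refine csSup_le (Set.Nonempty.image _ ⟨0, self_mem_Ici⟩) ?_
  rintro _ ⟨x, hx, rfl⟩
  exact hb x hx

lemma conj_nonneg (h : IsNFunction Φ) (y : ℝ) : 0 ≤ youngConj Φ y := by
  simpa [h.zero] using h.le_conj le_rfl y

/-- Convexity of the conjugate along rays from the origin. It is the source of `conjInv_mul_le`, the
corresponding concavity of the inverse. -/
lemma conj_mul_ge (h : IsNFunction Φ) {c : ℝ} (hc : 1 ≤ c) (y : ℝ) :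
    c * youngConj Φ y ≤ youngConj Φ (c * y) := by
  have hc0 : 0 < c := one_pos.trans_le hc
  rw [mul_comm, ← le_div_iff₀ hc0]
  refine conj_le fun x hx => ?_
  rw [le_div_iff₀ hc0]
  have := h.le_conj hx (c * y)
  rw [abs_mul, abs_of_pos hc0] at this
  nlinarith [h.nonneg x]

lemma conjInv_set_nonempty (h : IsNFunction Φ) (x : ℝ) :
    {t | 0 ≤ t ∧ x ≤ youngConj Φ t}.Nonempty := by
  refine ⟨|x| + Φ 1, by positivity [h.nonneg 1], ?_⟩
  have h1 := h.nonneg 1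
  have := h.le_conj zero_le_one (|x| + Φ 1)
  rw [abs_of_nonneg (by positivity)] at this
  linarith [le_abs_self x]

end IsNFunction

lemma rInv_set_bddBelow (g : ℝ → ℝ) (y : ℝ) : BddBelow {x | 0 ≤ x ∧ y ≤ g x} :=
  ⟨0, fun _ hx => hx.1⟩

lemma rInv_nonneg (g : ℝ → ℝ) (y : ℝ) : 0 ≤ rInv g y := Real.sInf_nonneg fun _ hx => hx.1

lemma rInv_le {g : ℝ → ℝ} {x y : ℝ} (hx : 0 ≤ x) (h : y ≤ g x) : rInv g y ≤ x :=
  csInf_le (rInv_set_bddBelow g y) ⟨hx, h⟩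

lemma rInv_mono {g : ℝ → ℝ} {y z : ℝ} (hz : {x | 0 ≤ x ∧ z ≤ g x}.Nonempty) (hyz : y ≤ z) :
    rInv g y ≤ rInv g z :=
  csInf_le_csInf (rInv_set_bddBelow g y) hz fun _ hx => ⟨hx.1, hyz.trans hx.2⟩

lemma rInv_apply_of_strictMonoOn {g : ℝ → ℝ} (hg : StrictMonoOn g (Ici 0)) {x : ℝ} (hx : 0 ≤ x) :
    rInv g (g x) = x :=
  le_antisymm (rInv_le hx le_rfl)
    (le_csInf ⟨x, hx, le_rfl⟩ fun _ hz => (hg.le_iff_le hx hz.1).1 hz.2)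

namespace IsNFunction

variable {Φ : ℝ → ℝ}

lemma conjInv_mono (h : IsNFunction Φ) : Monotone (rInv (youngConj Φ)) :=
  fun _ z hyz => rInv_mono (h.conjInv_set_nonempty z) hyz

lemma conjInv_mul_le (h : IsNFunction Φ) {c : ℝ} (hc : 1 ≤ c) {x : ℝ} :
    rInv (youngConj Φ) (c * x) ≤ c * rInv (youngConj Φ) x := by
  have hc0 : 0 < c := one_pos.trans_le hc
  rw [mul_comm c (rInv _ _), ← div_le_iff₀ hc0]
  refine le_csInf (h.conjInv_set_nonempty x) fun t ht => ?_
  rw [div_le_iff₀ hc0, mul_comm t]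
  exact rInv_le (mul_nonneg hc0.le ht.1)
    ((mul_le_mul_of_nonneg_left ht.2 hc0.le).trans (h.conj_mul_ge hc t))

/-- Superlinearity confines the competitors in the supremum to a bounded interval: for slopes `t ≤
1` the conjugate is at most `M t`, so it cannot reach `x > 0` before `t = min 1 (x / M)`. -/
lemma conjInv_pos (h : IsNFunction Φ) {x : ℝ} (hx : 0 < x) : 0 < rInv (youngConj Φ) x := by
  obtain ⟨M, hM0, hM⟩ := h.exists_mul_le 1
  have : min 1 (x / M) ≤ rInv (youngConj Φ) x := by
    refine le_csInf (h.conjInv_set_nonempty x) fun t ht => ?_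
    by_contra! hlt
    have h1 : |t| = t := abs_of_nonneg ht.1
    have h2 : youngConj Φ t ≤ M * |t| := conj_le fun u hu =>
      h.conj_aux hM0 hM (h1.le.trans (hlt.le.trans (min_le_left _ _))) hu
    have h3 : t < x / M := hlt.trans_le (min_le_right _ _)
    rw [lt_div_iff₀ hM0] at h3
    rw [h1] at h2
    linarith [ht.2]
  exact lt_of_lt_of_le (by positivity) this

/-- Fenchel equality at a point where a supporting line is chosen. -/
lemma exists_conj_eq (h : IsNFunction Φ) {z : ℝ} (hz : 0 < z) :
    ∃ p, 0 ≤ p ∧ Φ z = z * p - youngConj Φ p := by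
  have hint : z ∈ interior (univ : Set ℝ) := by simp
  obtain ⟨p, hp⟩ : ∃ p : ℝ, ∀ u, Φ z + p * (u - z) ≤ Φ u := by
    refine ⟨derivWithin Φ (Ioi z) z, fun u => ?_⟩
    have h1 := h.convex.leftDeriv_le_rightDeriv_of_mem_interior hint
    rcases lt_trichotomy u z with hu | hu | hu
    · have := (h.convex.slope_le_leftDeriv_of_mem_interior (mem_univ u) hint hu).trans h1
      rw [slope_def_field, div_le_iff₀ (by linarith)] at this
      linarith
    · simp [hu]
    · have := h.convex.rightDeriv_le_slope_of_mem_interior hint (mem_univ u) hu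
      rw [slope_def_field, le_div_iff₀ (by linarith)] at this
      linarith
  have hp0 : 0 ≤ p := by
    have h0 := hp 0
    rw [h.zero] at h0
    nlinarith [h.nonneg z]
  refine ⟨p, hp0, le_antisymm ?_ ?_⟩
  · have : youngConj Φ p ≤ z * p - Φ z := conj_le fun u _ => by
      rw [abs_of_nonneg hp0]; linarith [hp u]
    linarith
  · have := h.le_conj hz.le p
    rw [abs_of_nonneg hp0] at this
    linarith

/-- Let `p` be the slope of a supporting line at `z = x / t`, so `Φ z = z p - Φ* p`. If `p ≤ t`,
then `Φ z ≤ z t = x`. If `p > t`, growth of `Φ*` along rays gives `Φ* p ≥ p x / t = z p`, hence `Φ z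
≤ 0`. This estimate yields the norm of an indicator. -/
lemma apply_div_conjInv_le (h : IsNFunction Φ) {x : ℝ} (hx : 0 < x) :
    Φ (x / rInv (youngConj Φ) x) ≤ x := by
  set t := rInv (youngConj Φ) x with ht
  have ht0 : 0 < t := h.conjInv_pos hx
  have hz : 0 < x / t := by positivity
  obtain ⟨p, hp0, hp⟩ := h.exists_conj_eq hz
  rcases le_or_gt p t with hpt | hpt
  · rw [hp]
    have h1 : x / t * p ≤ x / t * t := by gcongr
    rw [div_mul_cancel₀ _ ht0.ne'] at h1
    linarith [h.conj_nonneg p]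
  · have key : p * x / t ≤ youngConj Φ p := by
      rw [div_le_iff₀ ht0]
      -- The infimum defining `t` is not assumed attained, so the ray inequality is used at some `τ`
      -- slightly above `t`, close enough that `Φ* p * τ < b`.
      refine le_of_forall_gt_imp_ge_of_dense fun b hb => ?_
      have hp' : 0 < p := ht0.trans hpt
      have hc : 0 ≤ youngConj Φ p := h.conj_nonneg p
      obtain ⟨τ, hτ, hτ2⟩ : ∃ τ ∈ {t | 0 ≤ t ∧ x ≤ youngConj Φ t},
          τ < min p (t + (b - youngConj Φ p * t) / (youngConj Φ p + 1)) := by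
        refine exists_lt_of_csInf_lt (h.conjInv_set_nonempty x) (lt_min hpt ?_)
        change t < _
        have : 0 < (b - youngConj Φ p * t) / (youngConj Φ p + 1) := by
          apply div_pos <;> linarith
        linarith
      obtain ⟨hτp, hτb⟩ := lt_min_iff.1 hτ2
      have hτt : t ≤ τ := rInv_le hτ.1 hτ.2
      have hτ0 : 0 < τ := ht0.trans_le hτt
      have h2 := h.conj_mul_ge (c := p / τ) ((one_le_div hτ0).2 hτp.le) τ
      rw [div_mul_cancel₀ _ hτ0.ne', div_mul_eq_mul_div, div_le_iff₀ hτ0] at h2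
      have h3 : p * x ≤ p * youngConj Φ τ := mul_le_mul_of_nonneg_left hτ.2 hp0
      have h4 : (τ - t) * (youngConj Φ p + 1) < b - youngConj Φ p * t := by
        rw [← lt_div_iff₀ (by linarith)]; linarith
      nlinarith
    have : x / t * p = p * x / t := by ring
    rw [hp, this]
    linarith

end IsNFunction

/-! ### Smooth approximation of Lipschitz functions by mollification -/

/-- Rescaling a fixed bump preserves its mass and multiplies the `L¹` norm of its derivative by `1 /
ε`; `K` is that norm at unit scale. -/
lemma exists_mollifier (n : ℕ) : ∃ K : ℝ, 0 ≤ K ∧ ∀ ε : ℝ, 0 < ε →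
    ∃ φ : EuclideanSpace ℝ (Fin n) → ℝ, ContDiff ℝ ∞ φ ∧ HasCompactSupport φ ∧ (∀ t, 0 ≤ φ t) ∧
      ∫ t, φ t = 1 ∧ (∀ t, ε < ‖t‖ → φ t = 0) ∧ ∫ t, ‖fderiv ℝ φ t‖ ≤ K / ε := by
  let b : ContDiffBump (0 : EuclideanSpace ℝ (Fin n)) := ⟨1 / 2, 1, by norm_num, by norm_num⟩
  set ψ := b.normed volume with hψ
  have hψs : ContDiff ℝ ∞ ψ := b.contDiff_normed
  refine ⟨∫ t, ‖fderiv ℝ ψ t‖, integral_nonneg fun _ => norm_nonneg _, fun ε hε => ?_⟩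
  set c : ℝ := (ε ^ n)⁻¹ with hc
  have hc0 : 0 < c := by positivity
  have hsm : ContDiff ℝ ∞ fun t => c * ψ (ε⁻¹ • t) :=
    contDiff_const.mul (hψs.comp (contDiff_const_smul ε⁻¹))
  have hsupp : ∀ t : EuclideanSpace ℝ (Fin n), ε < ‖t‖ → c * ψ (ε⁻¹ • t) = 0 := by
    intro t ht
    have : ε⁻¹ • t ∉ Function.support ψ := by
      rw [hψ, b.support_normed_eq]
      simp only [Metric.mem_ball, dist_zero_right, norm_smul, norm_inv, Real.norm_eq_abs,
        abs_of_pos hε, not_lt]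
      change 1 ≤ _
      rw [inv_mul_eq_div, one_le_div hε]
      exact ht.le
    rw [Function.notMem_support.1 this, mul_zero]
  refine ⟨fun t => c * ψ (ε⁻¹ • t), hsm, ?_, fun t => mul_nonneg hc0.le (b.nonneg_normed _), ?_,
    hsupp, ?_⟩
  · refine HasCompactSupport.of_support_subset_isCompact
      (isCompact_closedBall (0 : EuclideanSpace ℝ (Fin n)) ε) fun t ht => ?_
    rw [mem_closedBall_zero_iff]
    by_contra! h
    exact ht (hsupp t h)
  · rw [integral_const_mul, Measure.integral_comp_inv_smul_of_nonneg _ _ hε.le, b.integral_normed]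
    simp [hc, hε.ne']
  · have hd : ∀ t, fderiv ℝ (fun t => c * ψ (ε⁻¹ • t)) t = (c * ε⁻¹) • fderiv ℝ ψ (ε⁻¹ • t) := by
      intro t
      have h1 := ((hψs.differentiable (by simp)) (ε⁻¹ • t)).hasFDerivAt
      have h2 : HasFDerivAt (fun t : EuclideanSpace ℝ (Fin n) => ε⁻¹ • t)
          (ε⁻¹ • ContinuousLinearMap.id ℝ _) t := (hasFDerivAt_id t).const_smul ε⁻¹
      have h3 := (h1.comp t h2).const_mul c
      refine h3.fderiv.trans ?_
      ext v
      simp [mul_assoc]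
    simp_rw [hd, norm_smul]
    rw [integral_const_mul,
      Measure.integral_comp_inv_smul_of_nonneg volume (fun t => ‖fderiv ℝ ψ t‖) hε.le]
    simp only [finrank_euclideanSpace, Fintype.card_fin, smul_eq_mul, Real.norm_eq_abs,
      abs_of_pos (mul_pos hc0 (inv_pos.2 hε))]
    rw [hc]
    apply le_of_eq
    field_simp

section Mollify

variable {n : ℕ} {φ h : EuclideanSpace ℝ (Fin n) → ℝ}

/-- The convolution of two real functions on a Euclidean space. -/
noncomputable abbrev mollify (φ h : EuclideanSpace ℝ (Fin n) → ℝ) : EuclideanSpace ℝ (Fin n) → ℝ :=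
  MeasureTheory.convolution φ h (ContinuousLinearMap.lsmul ℝ ℝ) volume

lemma mollify_integrable (hφ : ContDiff ℝ ∞ φ) (hφc : HasCompactSupport φ) (hh : Continuous h)
    (x : EuclideanSpace ℝ (Fin n)) : Integrable fun t => φ t * h (x - t) :=
  (hφ.continuous.mul (hh.comp (continuous_const.sub continuous_id))).integrable_of_hasCompactSupport
    hφc.mul_right

lemma mollify_dist_le {ε L : ℝ} (hφ : ContDiff ℝ ∞ φ) (hφc : HasCompactSupport φ)
    (hφ0 : ∀ t, 0 ≤ φ t) (hφ1 : ∫ t, φ t = 1) (hφs : ∀ t, ε < ‖t‖ → φ t = 0)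
    (hL : 0 ≤ L) (hh : Continuous h) (x : EuclideanSpace ℝ (Fin n))
    (hx : ∀ y, |h (x - y) - h x| ≤ L * ‖y‖) :
    |mollify φ h x - h x| ≤ L * ε := by
  have hi : Integrable φ := hφ.continuous.integrable_of_hasCompactSupport hφc
  have h1 : mollify φ h x - h x = ∫ t, φ t * (h (x - t) - h x) := by
    simp_rw [mul_sub]
    rw [integral_sub (mollify_integrable hφ hφc hh x) (hi.mul_const _), integral_mul_const, hφ1,
      one_mul]
    simp [convolution_def]
  rw [h1, ← Real.norm_eq_abs]
  refine (norm_integral_le_of_norm_le (hi.mul_const (L * ε)) (.of_forall fun t => ?_)).trans ?_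
  · rw [norm_mul, Real.norm_eq_abs, Real.norm_eq_abs, abs_of_nonneg (hφ0 t)]
    by_cases ht : ε < ‖t‖
    · simp [hφs t ht]
    · exact mul_le_mul_of_nonneg_left ((hx t).trans
        (mul_le_mul_of_nonneg_left (not_lt.1 ht) hL)) (hφ0 t)
  · rw [integral_mul_const, hφ1, one_mul]

lemma mollify_lipschitz {L : NNReal} (hφ : ContDiff ℝ ∞ φ) (hφc : HasCompactSupport φ)
    (hφ0 : ∀ t, 0 ≤ φ t) (hφ1 : ∫ t, φ t = 1) (hh : LipschitzWith L h) :
    LipschitzWith L (mollify φ h) := by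
  have hi : Integrable φ := hφ.continuous.integrable_of_hasCompactSupport hφc
  refine LipschitzWith.of_dist_le_mul fun x y => ?_
  rw [Real.dist_eq]
  have h1 : mollify φ h x - mollify φ h y = ∫ t, φ t * (h (x - t) - h (y - t)) := by
    simp_rw [mul_sub]
    rw [integral_sub (mollify_integrable hφ hφc hh.continuous x)
      (mollify_integrable hφ hφc hh.continuous y)]
    simp [convolution_def]
  rw [h1, ← Real.norm_eq_abs]
  refine (norm_integral_le_of_norm_le (hi.mul_const (L * dist x y)) (.of_forall fun t => ?_)).trans ?_
  · rw [norm_mul, Real.norm_eq_abs, Real.norm_eq_abs, abs_of_nonneg (hφ0 t)]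
    refine mul_le_mul_of_nonneg_left ?_ (hφ0 t)
    have := hh.dist_le_mul (x - t) (y - t)
    rwa [Real.dist_eq, dist_sub_right] at this
  · rw [integral_mul_const, hφ1, one_mul]

lemma mollify_contDiff (hφ : ContDiff ℝ ∞ φ) (hφc : HasCompactSupport φ) (hh : Continuous h) :
    ContDiff ℝ ∞ (mollify φ h) :=
  hφc.contDiff_convolution_left (n := ⊤) _ hφ hh.locallyIntegrable

/-- Subtracting the affine part leaves the Taylor remainder `r`, which is at most `η ε` on the
support of `φ`. Letting the derivative fall on `φ` costs its `L¹` norm, of order `1 / ε`, so the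
powers of `ε` cancel and differentiability at the single point `x` suffices. -/
lemma mollify_fderiv_sub_le {ε η : ℝ} (hφ : ContDiff ℝ ∞ φ) (hφc : HasCompactSupport φ)
    (hφ1 : ∫ t, φ t = 1) (hφs : ∀ t, ε < ‖t‖ → φ t = 0) (hη : 0 ≤ η)
    (hh : Continuous h) (x : EuclideanSpace ℝ (Fin n)) (A : EuclideanSpace ℝ (Fin n) →L[ℝ] ℝ)
    (hx : ∀ t, ‖t‖ ≤ ε → |h (x - t) - h x + A t| ≤ η * ‖t‖) :
    ‖fderiv ℝ (mollify φ h) x - A‖ ≤ η * ε * ∫ t, ‖fderiv ℝ φ t‖ := by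
  set r : EuclideanSpace ℝ (Fin n) → ℝ := fun y => h y - h x - A (y - x) with hr
  have hrc : Continuous r := by fun_prop
  have hi : Integrable φ := hφ.continuous.integrable_of_hasCompactSupport hφc
  have hA : Integrable fun t => φ t * A t :=
    (hφ.continuous.mul A.continuous).integrable_of_hasCompactSupport hφc.mul_right
  have hφ' : ContDiff ℝ 1 φ := hφ.of_le (by simp)
  have hdr := hφc.hasFDerivAt_convolution_left (ContinuousLinearMap.lsmul ℝ ℝ) hφ'
    (hrc.locallyIntegrable (μ := volume)) x
  have heq : mollify φ h = fun y => mollify φ r y + (h x + A (y - x) - ∫ t, φ t * A t) := by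
    funext y
    have h1 : ∀ t, φ t * h (y - t)
        = φ t * r (y - t) + (φ t * (h x + A (y - x)) - φ t * A t) := by
      intro t
      simp only [hr, map_sub]
      ring
    simp only [convolution_def, ContinuousLinearMap.lsmul_apply, smul_eq_mul]
    simp_rw [h1]
    rw [integral_add (mollify_integrable hφ hφc hrc y) 
        (show Integrable fun t => φ t * (h x + A (y - x)) - φ t * A t from (hi.mul_const _).sub hA),
      integral_sub (hi.mul_const _) hA, integral_mul_const, hφ1, one_mul]
  have hd : HasFDerivAt (mollify φ h) (convolution (fderiv ℝ φ) r
      ((ContinuousLinearMap.lsmul ℝ ℝ).precompL (EuclideanSpace ℝ (Fin n))) volume x + A) x := by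
    rw [heq]
    refine hdr.add ?_
    have : HasFDerivAt (fun y => A (y - x)) A x := by
      simp only [map_sub]
      exact A.hasFDerivAt.sub_const _
    simpa using (this.const_add (h x)).sub_const (∫ t, φ t * A t)
  rw [hd.fderiv, add_sub_cancel_right, convolution_def, ← integral_const_mul]
  have hic : Integrable fun t => ‖fderiv ℝ φ t‖ :=
    ((hφ'.continuous_fderiv one_ne_zero).integrable_of_hasCompactSupport (hφc.fderiv ℝ)).norm
  refine norm_integral_le_of_norm_le (hic.const_mul _) (.of_forall fun t => ?_)
  have hop : ((ContinuousLinearMap.lsmul ℝ ℝ).precompL (EuclideanSpace ℝ (Fin n)))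
      (fderiv ℝ φ t) (r (x - t)) = r (x - t) • fderiv ℝ φ t := by
    ext v
    simp [ContinuousLinearMap.precompL_apply, mul_comm]
  rw [hop, norm_smul]
  by_cases ht : ε < ‖t‖
  · have : fderiv ℝ φ t = 0 := by
      have : φ =ᶠ[𝓝 t] fun _ => 0 := by
        filter_upwards [(isOpen_lt continuous_const continuous_norm).mem_nhds ht] with s hs
        exact hφs s hs
      rw [this.fderiv_eq]; simp
    simp [this]
  · refine mul_le_mul_of_nonneg_right ?_ (norm_nonneg _)
    have h2 := hx t (not_lt.1 ht)
    have h3 : r (x - t) = h (x - t) - h x + A t := by simp [hr]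
    rw [h3, Real.norm_eq_abs]
    exact h2.trans (mul_le_mul_of_nonneg_left (not_lt.1 ht) hη)

/-- A Lipschitz function is approximated uniformly by smooth ones whose derivatives stay bounded
and converge at every point of differentiability. -/
lemma exists_smooth_approx {L : NNReal} (hh : LipschitzWith L h) :
    ∃ g : ℕ → EuclideanSpace ℝ (Fin n) → ℝ, ∃ δ : ℕ → ℝ, Tendsto δ atTop (𝓝 0) ∧
      (∀ k, ContDiff ℝ ∞ (g k)) ∧ (∀ k x, |g k x - h x| ≤ δ k) ∧ (∀ k x, ‖fderiv ℝ (g k) x‖ ≤ L) ∧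
      ∀ x, DifferentiableAt ℝ h x →
        Tendsto (fun k => fderiv ℝ (g k) x) atTop (𝓝 (fderiv ℝ h x)) := by
  obtain ⟨K, hK, hm⟩ := exists_mollifier n
  have hε : ∀ k : ℕ, (0 : ℝ) < 1 / ((k : ℝ) + 1) := fun k => Nat.one_div_pos_of_nat
  choose φ h1 h2 h3 h4 h5 h6 using fun k : ℕ => hm _ (hε k)
  have hlim : Tendsto (fun k : ℕ => 1 / ((k : ℝ) + 1)) atTop (𝓝 0) :=
    tendsto_one_div_add_atTop_nhds_zero_nat
  refine ⟨fun k => mollify (φ k) h, fun k => L * (1 / ((k : ℝ) + 1)), ?_,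
    fun k => mollify_contDiff (h1 k) (h2 k) hh.continuous, fun k x => ?_, fun k x => ?_,
    fun x hx => ?_⟩
  · simpa using hlim.const_mul (L : ℝ)
  · refine mollify_dist_le (h1 k) (h2 k) (h3 k) (h4 k) (h5 k) L.2 hh.continuous x fun y => ?_
    have := hh.dist_le_mul (x - y) x
    simpa [Real.dist_eq, dist_eq_norm] using this
  · exact norm_fderiv_le_of_lipschitz ℝ (mollify_lipschitz (h1 k) (h2 k) (h3 k) (h4 k) hh)
  · rw [Metric.tendsto_atTop]
    intro η hη
    -- Chosen so that, after multiplication by the derivative mass `K / ε` and by `ε`, less than `η`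
    -- remains.
    have hη' : 0 < η / (2 * (K + 1)) := by positivity
    have hd := hx.hasFDerivAt.isLittleO.def hη'
    obtain ⟨ρ, hρ, hρ'⟩ := Metric.eventually_nhds_iff.1 hd
    obtain ⟨N, hN⟩ := eventually_atTop.1 (hlim.eventually_lt_const hρ)
    refine ⟨N, fun k hk => ?_⟩
    rw [dist_eq_norm]
    refine (mollify_fderiv_sub_le (h1 k) (h2 k) (h4 k) (h5 k) hη'.le hh.continuous x
      (fderiv ℝ h x) fun t ht => ?_).trans_lt ?_
    · have := hρ' (y := x - t) (by simpa [dist_eq_norm] using ht.trans_lt (hN k hk))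
      simpa using this
    · have h7 := mul_le_mul_of_nonneg_left (h6 k) (mul_pos hη' (hε k)).le
      refine h7.trans_lt ?_
      have h8 : η / (2 * (K + 1)) * (1 / ((k : ℝ) + 1)) * (K / (1 / ((k : ℝ) + 1)))
          = η * (K / (2 * (K + 1))) := by
        have := (hε k).ne'
        field_simp
      rw [h8]
      have : K / (2 * (K + 1)) < 1 := by rw [div_lt_one (by positivity)]; linarith
      nlinarith

end Mollify

/-! ### Calculus of upper bounds for the Luxemburg norm -/

/-- `S` bounds the Luxemburg norm of `u`. -/
def LuxLe {X : Type*} [MeasurableSpace X] (Φ : ℝ → ℝ) (μ : Measure X) (u : X → ℝ) (S : ℝ) : Prop :=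
  ∀ c, S < c → ∫⁻ x, ENNReal.ofReal (Φ (u x / c)) ∂μ ≤ 1

namespace LuxLe

variable {X : Type*} [MeasurableSpace X] {Φ : ℝ → ℝ} {μ : Measure X} {u v : X → ℝ} {S T : ℝ}

lemma mono (h : LuxLe Φ μ u S) (hST : S ≤ T) : LuxLe Φ μ u T := fun c hc => h c (hST.trans_lt hc)

lemma of_forall_add (h : ∀ ε, 0 < ε → LuxLe Φ μ u (S + ε)) : LuxLe Φ μ u S := fun c hc =>
  h ((c - S) / 2) (by linarith) c (by linarith)

lemma of_abs_le (hΦ : IsYoungFunction Φ) (h : LuxLe Φ μ v S) (hS : 0 ≤ S)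
    (huv : ∀ x, |u x| ≤ v x) : LuxLe Φ μ u S := fun c hc => by
  have hc0 : 0 < c := hS.trans_lt hc
  refine (lintegral_mono fun x => ENNReal.ofReal_le_ofReal (hΦ.le_of_abs_le ?_)).trans (h c hc)
  rw [abs_div, abs_of_pos hc0]
  gcongr
  exact huv x

lemma const_mul {b : ℝ} (hb : 0 < b) (h : LuxLe Φ μ u S) : LuxLe Φ μ (fun x => b * u x) (b * S) :=
  fun c hc => by
  refine le_of_eq_of_le ?_ (h (c / b) (by rwa [lt_div_iff₀ hb, mul_comm]))
  congr 1 with x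
  congr 2
  field_simp

lemma add (hΦ : IsNFunction Φ) (hu : LuxLe Φ μ u S) (hv : LuxLe Φ μ v T) (hS : 0 ≤ S)
    (hT : 0 ≤ T) (hum : Measurable u) : LuxLe Φ μ (fun x => u x + v x) (S + T) := fun c hc => by
  -- The slack is shared equally, so `(u + v) / c` is a convex combination of `u / (S + d)` and `v /
  -- (T + d)`.
  set d := (c - S - T) / 2 with hd
  have hd0 : 0 < d := by rw [hd]; linarith
  have hc0 : 0 < c := by linarith
  have hS' : 0 < S + d := by linarith
  have hT' : 0 < T + d := by linarith
  have hsum : (S + d) / c + (T + d) / c = 1 := by rw [hd]; field_simp; ring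
  have hp : ∀ x, ENNReal.ofReal (Φ ((u x + v x) / c)) ≤
      ENNReal.ofReal ((S + d) / c) * ENNReal.ofReal (Φ (u x / (S + d))) +
      ENNReal.ofReal ((T + d) / c) * ENNReal.ofReal (Φ (v x / (T + d))) := by
    intro x
    have hc' := hΦ.convex.2
    have h1 := hc' (mem_univ (u x / (S + d))) (mem_univ (v x / (T + d)))
      (div_pos hS' hc0).le (div_pos hT' hc0).le hsum
    simp only [smul_eq_mul] at h1
    rw [← ENNReal.ofReal_mul (by positivity), ← ENNReal.ofReal_mul (by positivity),
      ← ENNReal.ofReal_add (mul_nonneg (by positivity) (hΦ.nonneg _))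
        (mul_nonneg (by positivity) (hΦ.nonneg _))]
    refine ENNReal.ofReal_le_ofReal (le_of_eq_of_le ?_ h1)
    congr 1
    field_simp
  have hm : Measurable fun x => ENNReal.ofReal (Φ (u x / (S + d))) :=
    (hΦ.continuous.measurable.comp (hum.div_const _)).ennreal_ofReal
  refine (lintegral_mono hp).trans ?_
  rw [lintegral_add_left (hm.const_mul _), lintegral_const_mul' _ _ ENNReal.ofReal_ne_top,
    lintegral_const_mul' _ _ ENNReal.ofReal_ne_top]
  calc _ ≤ ENNReal.ofReal ((S + d) / c) * 1 + ENNReal.ofReal ((T + d) / c) * 1 := by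
        gcongr
        · exact hu _ (by linarith)
        · exact hv _ (by linarith)
    _ = 1 := by
        rw [mul_one, mul_one, ← ENNReal.ofReal_add (by positivity) (by positivity), hsum,
          ENNReal.ofReal_one]

lemma sum (hΦ : IsNFunction Φ) {u : ℕ → X → ℝ} {S : ℕ → ℝ} (hu : ∀ j, LuxLe Φ μ (u j) (S j))
    (hS : ∀ j, 0 ≤ S j) (hum : ∀ j, Measurable (u j)) (N : ℕ) :
    LuxLe Φ μ (fun x => ∑ j ∈ Finset.range N, u j x) (∑ j ∈ Finset.range N, S j) := by
  induction N with
  | zero => intro c _; simp [hΦ.zero]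
  | succ N ih =>
    simp only [Finset.sum_range_succ]
    exact ih.add hΦ (hu N) (Finset.sum_nonneg fun j _ => hS j) (hS N)
      (Finset.measurable_sum _ fun j _ => hum j)

/-- The modular of the indicator at `c` is `Φ(1/c) μ(A)`, and `apply_div_conjInv_le` at `1 / μ(A)`
makes it at most `1`. -/
lemma indicator (hΦ : IsNFunction Φ) [IsFiniteMeasure μ] {A : Set X} (hA : MeasurableSet A) :
    LuxLe Φ μ (A.indicator 1) (μ.real A * rInv (youngConj Φ) (1 / μ.real A)) := fun c hc => by
  set M := μ.real A with hM
  have hle : ∫⁻ x, ENNReal.ofReal (Φ (A.indicator 1 x / c)) ∂μ =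
      ENNReal.ofReal (Φ (1 / c)) * μ A := by
    rw [← lintegral_indicator_const hA]
    congr 1 with x
    by_cases hx : x ∈ A <;> simp [hx, hΦ.zero]
  rw [hle]
  rcases eq_or_lt_of_le (measureReal_nonneg : 0 ≤ μ.real A) with h0 | h0
  · rw [(measureReal_eq_zero_iff).1 h0.symm]; simp
  · rw [← hM] at h0
    have hR := hΦ.conjInv_pos (one_div_pos.2 h0)
    have hc0 : 0 < c := (mul_pos h0 hR).trans hc
    have h1 : Φ (1 / c) ≤ 1 / M := by
      refine le_trans (hΦ.le_of_abs_le ?_) (hΦ.apply_div_conjInv_le (one_div_pos.2 h0))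
      rw [abs_of_pos (one_div_pos.2 hc0), div_div]
      exact one_div_le_one_div_of_le (mul_pos h0 hR) hc.le
    calc _ ≤ ENNReal.ofReal (1 / M) * ENNReal.ofReal M := by
          rw [hM, ofReal_measureReal]
          gcongr
      _ = 1 := by
          rw [← ENNReal.ofReal_mul (by positivity), one_div_mul_cancel h0.ne', ENNReal.ofReal_one]

/-- Fatou's lemma: it passes from truncated layer sums to the function they dominate. -/
lemma of_eventually (hΦ : IsNFunction Φ) {w : ℕ → X → ℝ} (hw : ∀ N, LuxLe Φ μ (w N) S)
    (hS : 0 ≤ S) (hwm : ∀ N, Measurable (w N)) (huw : ∀ x, ∀ᶠ N in atTop, |u x| ≤ w N x) :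
    LuxLe Φ μ u S := fun c hc => by
  have hc0 : 0 < c := hS.trans_lt hc
  calc ∫⁻ x, ENNReal.ofReal (Φ (u x / c)) ∂μ
      ≤ ∫⁻ x, liminf (fun N => ENNReal.ofReal (Φ (w N x / c))) atTop ∂μ := by
        refine lintegral_mono fun x => le_liminf_of_le (by isBoundedDefault) ?_
        filter_upwards [huw x] with N hN
        refine ENNReal.ofReal_le_ofReal (hΦ.le_of_abs_le ?_)
        rw [abs_div, abs_of_pos hc0]
        gcongr
    _ ≤ liminf (fun N => ∫⁻ x, ENNReal.ofReal (Φ (w N x / c)) ∂μ) atTop :=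
        lintegral_liminf_le fun N =>
          (hΦ.continuous.measurable.comp ((hwm N).div_const _)).ennreal_ofReal
    _ ≤ 1 := liminf_le_of_le (by isBoundedDefault) fun b hb => by
        obtain ⟨N, hN⟩ := hb.exists
        exact hN.trans (hw N c hc)

lemma luxNorm_le (h : LuxLe Φ μ u S) (hS : 0 ≤ S) : luxNorm Φ μ u ≤ S :=
  le_of_forall_gt_imp_ge_of_dense fun c hc =>
    csInf_le ⟨0, fun _ ha => ha.1.le⟩ ⟨hS.trans_lt hc, h c hc⟩

lemma memOrlicz (h : LuxLe Φ μ u S) (hS : 0 ≤ S) (hu : Measurable u) : MemOrlicz Φ μ u := by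
  refine ⟨hu, (S + 1)⁻¹, by positivity, ?_⟩
  have := h (S + 1) (by linarith)
  simp_rw [div_eq_inv_mul] at this
  exact this.trans_lt ENNReal.one_lt_top

lemma luxNorm_nonneg : 0 ≤ luxNorm Φ μ u := Real.sInf_nonneg fun _ h => h.1.le

/-- The a priori bound `b` keeps the set defining `luxNorm` nonempty; otherwise the infimum would
take its default value `0`. -/
lemma of_luxNorm_le (hΦ : IsYoungFunction Φ) {b : ℝ} (hb : LuxLe Φ μ u b) (h : luxNorm Φ μ u ≤ S) :
    LuxLe Φ μ u S := fun c hc => by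
  have hne : {c | 0 < c ∧ ∫⁻ x, ENNReal.ofReal (Φ (u x / c)) ∂μ ≤ 1}.Nonempty :=
    ⟨|b| + 1, by positivity, hb _ (by linarith [le_abs_self b])⟩
  obtain ⟨c', ⟨hc'0, hc'⟩, hlt⟩ := exists_lt_of_csInf_lt hne (h.trans_lt hc)
  refine (lintegral_mono fun x => ENNReal.ofReal_le_ofReal ?_).trans hc'
  rw [← hΦ.map_abs (u x / c')]
  refine hΦ.le_of_abs_le ?_
  rw [abs_div, abs_div, abs_of_pos hc'0, abs_of_pos (hc'0.trans hlt)]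
  gcongr

/-- Since `Φ` dominates the identity beyond `M`, one has `|u| / c ≤ Φ(u / c) + M`. The constant is
uniform in `u` and `c`, so `c → 0` is allowed in `ae_eq_zero`. -/
lemma lintegral_le (hΦ : IsNFunction Φ) [IsProbabilityMeasure μ] : ∃ K : ℝ, ∀ (u : X → ℝ) (S : ℝ),
    0 ≤ S → LuxLe Φ μ u S → ∀ c, S < c → ∫⁻ x, ENNReal.ofReal |u x| ∂μ ≤ ENNReal.ofReal (c * K) := by
  obtain ⟨M, hM0, hM⟩ := hΦ.exists_mul_le 1
  refine ⟨1 + M, fun u S hS h c hc => ?_⟩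
  have hc0 : 0 < c := hS.trans_lt hc
  have hp : ∀ x, ENNReal.ofReal |u x| ≤
      ENNReal.ofReal c * (ENNReal.ofReal (Φ (u x / c)) + ENNReal.ofReal M) := by
    intro x
    rw [← ENNReal.ofReal_add (hΦ.nonneg _) hM0.le, ← ENNReal.ofReal_mul hc0.le]
    refine ENNReal.ofReal_le_ofReal ?_
    have : |u x| = c * (|u x| / c) := by field_simp
    rw [this]
    refine mul_le_mul_of_nonneg_left ?_ hc0.le
    have h2 : |u x / c| = |u x| / c := by rw [abs_div, abs_of_pos hc0]
    rw [← hΦ.map_abs, h2]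
    rcases le_total M (|u x| / c) with h1 | h1
    · linarith [hM _ h1]
    · linarith [hΦ.nonneg (|u x| / c)]
  refine (lintegral_mono hp).trans ?_
  rw [lintegral_const_mul' _ _ ENNReal.ofReal_ne_top, lintegral_add_right _ measurable_const,
    lintegral_const, measure_univ, mul_one, ENNReal.ofReal_mul hc0.le,
    ENNReal.ofReal_add zero_le_one hM0.le, ENNReal.ofReal_one]
  gcongr
  exact h c hc

lemma integrable (hΦ : IsNFunction Φ) [IsProbabilityMeasure μ] (h : LuxLe Φ μ u S) (hS : 0 ≤ S)
    (hu : Measurable u) : Integrable u μ := by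
  obtain ⟨K, hK⟩ := lintegral_le (μ := μ) hΦ
  refine ⟨hu.aestronglyMeasurable, ?_⟩
  simp_rw [hasFiniteIntegral_iff_norm, Real.norm_eq_abs]
  exact (hK u S hS h (S + 1) (by linarith)).trans_lt ENNReal.ofReal_lt_top

lemma ae_eq_zero (hΦ : IsNFunction Φ) [IsProbabilityMeasure μ] (h : LuxLe Φ μ u 0)
    (hu : Measurable u) : u =ᵐ[μ] 0 := by
  obtain ⟨K, hK⟩ := lintegral_le (μ := μ) hΦ
  have h0 : ∫⁻ x, ENNReal.ofReal |u x| ∂μ ≤ 0 := by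
    have ht : Tendsto (fun c : ℝ => ENNReal.ofReal (c * K)) (𝓝[>] 0) (𝓝 0) := by
      have : Tendsto (fun c : ℝ => ENNReal.ofReal (c * K)) (𝓝 0) (𝓝 (ENNReal.ofReal (0 * K))) :=
        (ENNReal.continuous_ofReal.comp (continuous_mul_const K)).tendsto 0
      rw [zero_mul, ENNReal.ofReal_zero] at this
      exact this.mono_left nhdsWithin_le_nhds
    exact ge_of_tendsto ht (eventually_mem_nhdsWithin.mono fun c hc => hK u 0 le_rfl h c hc)
  rw [nonpos_iff_eq_zero, lintegral_eq_zero_iff (by fun_prop)] at h0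
  filter_upwards [h0] with x hx
  simpa using hx

/-- Jensen's inequality for the modular. -/
lemma integral_const (hΦ : IsNFunction Φ) [IsProbabilityMeasure μ] (h : LuxLe Φ μ u S)
    (hu : Measurable u) (hui : Integrable u μ) : LuxLe Φ μ (fun _ => ∫ y, u y ∂μ) S := fun c hc => by
  have h1 := h c hc
  have hm : Measurable fun x => Φ (u x / c) := hΦ.continuous.measurable.comp (hu.div_const _)
  have hi : Integrable (fun x => Φ (u x / c)) μ := by
    refine ⟨hm.aestronglyMeasurable, ?_⟩
    rw [hasFiniteIntegral_iff_ofReal (.of_forall fun x => hΦ.nonneg _)]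
    exact h1.trans_lt ENNReal.one_lt_top
  have hj := hΦ.convex.map_integral_le hΦ.continuous.continuousOn isClosed_univ
    (.of_forall fun x => mem_univ (u x / c)) (hui.div_const c) hi
  rw [integral_div] at hj
  rw [lintegral_const, measure_univ, mul_one]
  refine (ENNReal.ofReal_le_ofReal hj).trans ?_
  rwa [ofReal_integral_eq_lintegral_ofReal hi (.of_forall fun x => hΦ.nonneg _)]

lemma exists_const (hΦ : IsNFunction Φ) [IsProbabilityMeasure μ] (hS : 0 < S) :
    ∃ η, 0 < η ∧ ∀ a, |a| ≤ η → LuxLe Φ μ (fun _ => a) S := by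
  have hcont : Tendsto Φ (𝓝 0) (𝓝 0) := by simpa [hΦ.zero] using hΦ.continuous.tendsto 0
  obtain ⟨η, hη, h⟩ := Metric.eventually_nhds_iff.1 (hcont.eventually_le_const one_pos)
  refine ⟨η / 2 * S, by positivity, fun a ha c hc => ?_⟩
  have : Φ (a / c) ≤ 1 := by
    apply h
    rw [dist_zero_right, Real.norm_eq_abs, abs_div, abs_of_pos (hS.trans hc)]
    rw [div_lt_iff₀ (hS.trans hc)]
    nlinarith
  simpa using this

end LuxLe

/-! ### The function `θ` and `Ψ`-norms of functions with small support -/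

section Theta

variable {Φ ψ : ℝ → ℝ}

lemma nashTheta_nonneg (x : ℝ) : 0 ≤ nashTheta Φ ψ x := rInv_nonneg _ _

lemma nashTheta_mono (hΦ : IsNFunction Φ) (hΨ : IsNFunction (quotSq ψ))
    (hψ_top : Tendsto ψ atTop atTop) : Monotone (nashTheta Φ ψ) := by
  intro x y hxy
  refine hΦ.conjInv_mono (hΨ.monotoneOn (rInv_nonneg _ _) (rInv_nonneg _ _) (rInv_mono ?_ hxy))
  obtain ⟨z, hz, hz'⟩ := ((hψ_top.eventually_ge_atTop y).and (eventually_ge_atTop 0)).exists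
  exact ⟨z, hz', hz⟩

lemma nashTheta_apply (hψ_mono : StrictMonoOn ψ (Ici 0)) {y : ℝ} (hy : 0 ≤ y) :
    nashTheta Φ ψ (ψ y) = rInv (youngConj Φ) (quotSq ψ y) := by
  rw [nashTheta, rInv_apply_of_strictMonoOn hψ_mono hy]

/-- Below `y` monotonicity gives `Ψ(us) ≤ Ψ(y)`; above `y` the denominator satisfies `ψ(us) ≥ ψ(y) =
s²`, which leaves `u²`. -/
lemma quotSq_mul_le (hΨ : IsNFunction (quotSq ψ)) (hψ_mono : StrictMonoOn ψ (Ici 0))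
    (hψ_zero : ψ 0 = 0) {u s y : ℝ} (hy : 0 < y) (hs : 0 < s) (hsy : s ^ 2 = ψ y) (hu : 0 ≤ u) :
    quotSq ψ (u * s) ≤ u ^ 2 + quotSq ψ y := by
  rcases le_or_gt (u * s) y with h | h
  · have := hΨ.monotoneOn (mem_Ici.2 (by positivity)) (mem_Ici.2 hy.le) h
    nlinarith
  · have hy' : 0 < ψ y := by
      rw [← hψ_zero]; exact hψ_mono self_mem_Ici hy.le hy
    have h1 : ψ y ≤ ψ (u * s) := (hψ_mono hy.le (hy.trans h).le h).le
    have h2 : quotSq ψ (u * s) ≤ u ^ 2 := by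
      rw [quotSq, abs_of_pos (hy.trans h), div_le_iff₀ (hy'.trans_le h1), mul_pow, hsy]
      gcongr
    linarith [hΨ.nonneg y]

/-- Apply `quotSq_mul_le` with `u = |h| / √a` on the set where `h ≠ 0`. Integration gives at most
`1` from `u²` and at most `1` from `Ψ(y) = 1 / M`. The factor `2` in the norm bound halves this
total by convexity. -/
lemma luxLe_quotSq {X : Type*} [MeasurableSpace X] {μ : Measure X} [IsProbabilityMeasure μ]
    (hΨ : IsNFunction (quotSq ψ)) (hψ_mono : StrictMonoOn ψ (Ici 0)) (hψ_zero : ψ 0 = 0)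
    {s y M : ℝ} (hy : 0 < y) (hs : 0 < s) (hsy : s ^ 2 = ψ y) (hM : 0 < M)
    (hyM : quotSq ψ y = 1 / M) {h : X → ℝ} (hm : Measurable h)
    (hi : Integrable (fun x => h x ^ 2) μ) (ha : 0 < ∫ x, h x ^ 2 ∂μ)
    (hA : μ.real {x | h x ≠ 0} ≤ M) :
    LuxLe (quotSq ψ) μ h (2 * √(∫ x, h x ^ 2 ∂μ) / s) := fun c hc => by
  set a := ∫ x, h x ^ 2 ∂μ with ha_def
  have hr : 0 < √a := Real.sqrt_pos.2 ha
  have hAm : MeasurableSet {x | h x ≠ 0} := (hm (measurableSet_singleton 0)).compl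
  have hc0 : 0 < 2 * √a / s := by positivity
  set g : X → ℝ := fun x => 1 / 2 * (h x ^ 2 / a + {x | h x ≠ 0}.indicator (fun _ => 1 / M) x)
    with hg
  have hgi : Integrable g μ :=
    ((hi.div_const a).add ((integrable_const (1 / M)).indicator hAm)).const_mul _
  have hle : ∀ x, quotSq ψ (h x / c) ≤ g x := by
    intro x
    by_cases hx : h x = 0
    · simp [hx, hg, hΨ.zero]
    · have h1 : |h x / c| ≤ 1 / 2 * (|h x| / √a * s) := by
        rw [abs_div, abs_of_pos (hc0.trans hc), div_le_iff₀ (hc0.trans hc)]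
        have : 1 / 2 * (|h x| / √a * s) * c = |h x| * (c / (2 * √a / s)) := by
          field_simp
        rw [this]
        exact le_mul_of_one_le_right (abs_nonneg _) ((one_le_div hc0).2 hc.le)
      have h2 := hΨ.map_mul_le one_half_pos.le (by norm_num : (1 / 2 : ℝ) ≤ 1) (|h x| / √a * s)
      have h3 := quotSq_mul_le hΨ hψ_mono hψ_zero hy hs hsy
        (div_nonneg (abs_nonneg (h x)) hr.le)
      rw [div_pow, sq_abs, Real.sq_sqrt ha.le, hyM] at h3
      have h4 : g x = 1 / 2 * (h x ^ 2 / a + 1 / M) := by simp [hg, hx]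
      rw [h4]
      linarith [hΨ.le_of_abs_le h1]
  calc _ ≤ ∫⁻ x, ENNReal.ofReal (g x) ∂μ :=
        lintegral_mono fun x => ENNReal.ofReal_le_ofReal (hle x)
    _ = ENNReal.ofReal (∫ x, g x ∂μ) := by
        rw [ofReal_integral_eq_lintegral_ofReal hgi]
        exact .of_forall fun x => (hΨ.nonneg _).trans (hle x)
    _ ≤ 1 := by
        rw [ENNReal.ofReal_le_one, hg, integral_const_mul, integral_add (hi.div_const a)
          ((integrable_const (1 / M)).indicator hAm), integral_div, ← ha_def, div_self ha.ne',
          integral_indicator_const _ hAm, smul_eq_mul, mul_one_div]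
        have := (div_le_one hM).2 hA
        linarith

end Theta

/-- Cauchy–Schwarz against the indicator of the support, obtained by integrating the square of `h -
t` over that support with the optimal `t`. -/
lemma sq_integral_le {X : Type*} [MeasurableSpace X] {μ : Measure X} [IsProbabilityMeasure μ]
    {h : X → ℝ} {M : ℝ} (hM : 0 < M) (hm : Measurable h) (h1 : Integrable h μ)
    (h2 : Integrable (fun x => h x ^ 2) μ) (hA : μ.real {x | h x ≠ 0} ≤ M) :
    (∫ x, h x ∂μ) ^ 2 ≤ M * ∫ x, h x ^ 2 ∂μ := by
  have hAm : MeasurableSet {x | h x ≠ 0} := (hm (measurableSet_singleton 0)).compl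
  set t := (∫ x, h x ∂μ) / M with ht
  have hp : ∀ x, 0 ≤ h x ^ 2 - 2 * t * h x + {x | h x ≠ 0}.indicator (fun _ => t ^ 2) x := by
    intro x
    by_cases hx : h x = 0
    · simp [hx]
    · simp only [mem_ofPred_eq, hx, not_false_eq_true, indicator_of_mem, ne_eq]
      nlinarith [sq_nonneg (h x - t)]
  have h0 : 0 ≤ ∫ x, (h x ^ 2 - 2 * t * h x + {x | h x ≠ 0}.indicator (fun _ => t ^ 2) x) ∂μ :=
    integral_nonneg hp
  rw [integral_add (show Integrable (fun x => h x ^ 2 - 2 * t * h x) μ from h2.sub (h1.const_mul _))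
      ((integrable_const _).indicator hAm),
    integral_sub h2 (h1.const_mul _), integral_const_mul, integral_indicator_const _ hAm,
    smul_eq_mul] at h0
  have h3 : μ.real {x | h x ≠ 0} * t ^ 2 ≤ M * t ^ 2 := by gcongr
  have h4 : ∫ x, h x ∂μ = t * M := by rw [ht]; field_simp
  rw [h4] at h0 ⊢
  nlinarith

lemma norm_gradient_eq {n : ℕ} (f : EuclideanSpace ℝ (Fin n) → ℝ) (x : EuclideanSpace ℝ (Fin n)) :
    ‖gradient f x‖ = ‖fderiv ℝ f x‖ := by
  rw [gradient, LinearIsometryEquiv.norm_map]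

/-- The Nash-type inequality for smooth functions. -/
def NashIneq {n : ℕ} (μ : Measure (EuclideanSpace ℝ (Fin n))) (Φ ψ : ℝ → ℝ) (C : ℝ) : Prop :=
  ∀ f : EuclideanSpace ℝ (Fin n) → ℝ, ContDiff ℝ ∞ f → MemLp f 2 μ →
      Integrable (fun x => ‖gradient f x‖ ^ 2) μ →
      ProbabilityTheory.variance f μ *
          nashTheta Φ ψ (1 / 2 * (ProbabilityTheory.variance f μ /
            luxNorm (quotSq ψ) μ (fun x => f x - ∫ y, f y ∂μ) ^ 2)) ≤
        C * ∫ x, ‖gradient f x‖ ^ 2 ∂μ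

/-! ### From the Nash inequality to Faber–Krahn for bounded Lipschitz functions -/

section Approx

variable {n : ℕ} {μ : Measure (EuclideanSpace ℝ (Fin n))} [IsProbabilityMeasure μ]
  {h : EuclideanSpace ℝ (Fin n) → ℝ}

/-- Smooth approximation of a bounded Lipschitz function in the Sobolev space of `μ`. -/
lemma exists_smooth_sobolev_approx {L : NNReal} {B : ℝ} (hL : LipschitzWith L h)
    (hB : ∀ x, |h x| ≤ B) (hd : ∀ᵐ x ∂μ, DifferentiableAt ℝ h x) :
    ∃ g : ℕ → EuclideanSpace ℝ (Fin n) → ℝ, ∃ δ : ℕ → ℝ, Tendsto δ atTop (𝓝 0) ∧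
      (∀ k, ContDiff ℝ ∞ (g k)) ∧ (∀ k x, |g k x - h x| ≤ δ k) ∧
      (∀ k, MemLp (g k) 2 μ) ∧ (∀ k, Integrable (fun x => ‖gradient (g k) x‖ ^ 2) μ) ∧
      Tendsto (fun k => ∫ x, ‖gradient (g k) x‖ ^ 2 ∂μ) atTop (𝓝 (∫ x, ‖fderiv ℝ h x‖ ^ 2 ∂μ)) ∧
      Tendsto (fun k => ∫ x, g k x ∂μ) atTop (𝓝 (∫ x, h x ∂μ)) ∧
      Tendsto (fun k => ProbabilityTheory.variance (g k) μ) atTop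
        (𝓝 (∫ x, h x ^ 2 ∂μ - (∫ x, h x ∂μ) ^ 2)) := by
  obtain ⟨g, δ, h1, h2, h3, h4, h5⟩ := exists_smooth_approx hL
  have hgB : ∀ k x, |g k x| ≤ B + δ k := fun k x => by
    have := abs_add_le (h x) (g k x - h x)
    rw [add_sub_cancel] at this
    linarith [hB x, h3 k x]
  have hgm : ∀ k, AEStronglyMeasurable (g k) μ := fun k => (h2 k).continuous.aestronglyMeasurable
  have hgp : ∀ k, MemLp (g k) 2 μ := fun k =>
    MemLp.of_bound (hgm k) (B + δ k) (.of_forall fun x => hgB k x)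
  have hDm : ∀ k, AEStronglyMeasurable (fun x => ‖fderiv ℝ (g k) x‖ ^ 2) μ := fun k =>
    ((measurable_fderiv ℝ (g k)).norm.pow_const 2).aestronglyMeasurable
  have hDb : ∀ k x, ‖‖fderiv ℝ (g k) x‖ ^ 2‖ ≤ (L : ℝ) ^ 2 := fun k x => by
    rw [norm_pow, norm_norm]
    exact pow_le_pow_left₀ (norm_nonneg _) (h4 k x) 2
  have hconv : ∀ x, Tendsto (fun k => g k x) atTop (𝓝 (h x)) := fun x => by
    rw [tendsto_iff_norm_sub_tendsto_zero]
    exact squeeze_zero (fun _ => norm_nonneg _) (fun k => h3 k x) h1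
  have hbd : ∀ᶠ k in atTop, ∀ x, |g k x| ≤ B + 1 := by
    filter_upwards [h1.eventually_le_const one_pos] with k hk x
    linarith [hgB k x]
  have hint : Tendsto (fun k => ∫ x, g k x ∂μ) atTop (𝓝 (∫ x, h x ∂μ)) :=
    tendsto_integral_filter_of_dominated_convergence (fun _ => B + 1) (.of_forall hgm)
      (hbd.mono fun k hk => .of_forall fun x => hk x) (integrable_const _)
      (.of_forall hconv)
  have hint2 : Tendsto (fun k => ∫ x, g k x ^ 2 ∂μ) atTop (𝓝 (∫ x, h x ^ 2 ∂μ)) := by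
    refine tendsto_integral_filter_of_dominated_convergence (fun _ => (B + 1) ^ 2)
      (.of_forall fun k => (hgm k).pow 2) (hbd.mono fun k hk => .of_forall fun x => ?_)
      (integrable_const _) (.of_forall fun x => (hconv x).pow 2)
    rw [norm_pow, Real.norm_eq_abs]
    exact pow_le_pow_left₀ (abs_nonneg _) (hk x) 2
  refine ⟨g, δ, h1, h2, h3, hgp, fun k => ?_, ?_, hint, ?_⟩
  · simp_rw [norm_gradient_eq]
    exact Integrable.of_bound (hDm k) ((L : ℝ) ^ 2) (.of_forall fun x => hDb k x)
  · simp_rw [norm_gradient_eq]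
    refine tendsto_integral_of_dominated_convergence (fun _ => (L : ℝ) ^ 2) hDm
      (integrable_const _) (fun k => .of_forall fun x => hDb k x) ?_
    filter_upwards [hd] with x hx
    exact (h5 x hx).norm.pow 2
  · have hv : ∀ k, ProbabilityTheory.variance (g k) μ
        = ∫ x, g k x ^ 2 ∂μ - (∫ x, g k x ∂μ) ^ 2 := fun k => by
      rw [ProbabilityTheory.variance_eq_sub (hgp k)]; rfl
    simp_rw [hv]
    exact hint2.sub (hint.pow 2)

lemma NashIneq.mul_energy_nonneg {Φ ψ : ℝ → ℝ} {C : ℝ} (hN : NashIneq μ Φ ψ C) {L : NNReal} {B : ℝ}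
    (hL : LipschitzWith L h) (hB : ∀ x, |h x| ≤ B) (hd : ∀ᵐ x ∂μ, DifferentiableAt ℝ h x) :
    0 ≤ C * ∫ x, ‖fderiv ℝ h x‖ ^ 2 ∂μ := by
  obtain ⟨g, δ, -, h2, -, h4, h5, h6, -, -⟩ := exists_smooth_sobolev_approx hL hB hd
  exact ge_of_tendsto' (h6.const_mul C) fun k =>
    (mul_nonneg (ProbabilityTheory.variance_nonneg _ _) (nashTheta_nonneg _)).trans
      (hN (g k) (h2 k) (h4 k) (h5 k))

/-- A Faber–Krahn type inequality for bounded Lipschitz functions. -/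
lemma NashIneq.faberKrahn_of_lipschitz {Φ ψ : ℝ → ℝ} {C lam : ℝ} (hN : NashIneq μ Φ ψ C)
    (hΦ : IsNFunction Φ) (hΨ : IsNFunction (quotSq ψ))
    (hψ_mono : StrictMonoOn ψ (Ici 0)) (hψ_zero : ψ 0 = 0) (hψ_top : Tendsto ψ atTop atTop)
    (hlam : 0 < lam)
    (h_theta : ∀ x : ℝ, 0 ≤ x → lam * nashTheta Φ ψ x ≤ nashTheta Φ ψ (x / 16))
    {L : NNReal} {B M : ℝ} (hL : LipschitzWith L h) (hB : ∀ x, |h x| ≤ B)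
    (hd : ∀ᵐ x ∂μ, DifferentiableAt ℝ h x) (hM : 0 < M) (hM2 : M ≤ 1 / 2)
    (hA : μ.real {x | h x ≠ 0} ≤ M) :
    1 / 2 * (∫ x, h x ^ 2 ∂μ) * (lam ^ 2 * rInv (youngConj Φ) (1 / M)) ≤
      C * ∫ x, ‖fderiv ℝ h x‖ ^ 2 ∂μ := by
  have hm : Measurable h := hL.continuous.measurable
  have hp : MemLp h 2 μ := MemLp.of_bound hm.aestronglyMeasurable B (.of_forall fun x => hB x)
  have hi1 : Integrable h μ := hp.integrable one_le_two
  have hi2 : Integrable (fun x => h x ^ 2) μ := hp.integrable_sq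
  rcases eq_or_lt_of_le (show 0 ≤ ∫ x, h x ^ 2 ∂μ from integral_nonneg fun x => sq_nonneg (h x)) with ha | ha
  · rw [← ha]
    simpa using hN.mul_energy_nonneg hL hB hd
  obtain ⟨y, hy0, hy⟩ : ∃ y, 0 ≤ y ∧ quotSq ψ y = 1 / M := by
    obtain ⟨z, hz, hz0⟩ := ((hΨ.tendsto_atTop.eventually_ge_atTop (1 / M)).and
      (eventually_ge_atTop 0)).exists
    obtain ⟨y, hy, hy'⟩ := intermediate_value_Icc hz0 hΨ.continuous.continuousOn
      (show 1 / M ∈ Icc (quotSq ψ 0) (quotSq ψ z) from ⟨by rw [hΨ.zero]; positivity, hz⟩)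
    exact ⟨y, hy.1, hy'⟩
  have hy1 : 0 < y := by
    rcases eq_or_lt_of_le hy0 with h0 | h0
    · rw [← h0, hΨ.zero] at hy
      exact absurd hy (one_div_pos.2 hM).ne
    · exact h0
  have hψy : 0 < ψ y := by rw [← hψ_zero]; exact hψ_mono self_mem_Ici hy1.le hy1
  set s := √(ψ y) with hs
  have hs0 : 0 < s := Real.sqrt_pos.2 hψy
  have hsy : s ^ 2 = ψ y := Real.sq_sqrt hψy.le
  set a := ∫ x, h x ^ 2 ∂μ with ha_def
  set c₀ := 2 * √a / s with hc₀
  have hc0 : 0 < c₀ := by have := Real.sqrt_pos.2 ha; positivity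
  have hlux : LuxLe (quotSq ψ) μ h c₀ :=
    luxLe_quotSq hΨ hψ_mono hψ_zero hy1 hs0 hsy hM hy hm hi2 ha hA
  have hmean := hlux.integral_const hΨ hm hi1
  have hluxabs : LuxLe (quotSq ψ) μ (fun x => |h x|) c₀ := fun c hc => by
    refine le_of_eq_of_le ?_ (hlux c hc)
    congr 1 with x
    rw [← hΨ.map_abs (h x / c), ← hΨ.map_abs (|h x| / c), abs_div, abs_abs, abs_div]
  obtain ⟨η, hη, hηc⟩ := LuxLe.exists_const (μ := μ) hΨ hc0
  obtain ⟨g, δ, h1, h2, h3, h4, h5, h6, h7, h8⟩ := exists_smooth_sobolev_approx hL hB hd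
  have hsq := sq_integral_le hM hm hi1 hi2 hA
  rw [← ha_def] at h8 hsq
  have hvar : 1 / 2 * a ≤ a - (∫ x, h x ∂μ) ^ 2 := by nlinarith
  -- Two uses of the hypothesis on `θ`, with `16² = 256`, and `θ(ψ(y))` is the inverse conjugate at
  -- `Ψ(y) = 1 / M`.
  have hθ : lam ^ 2 * rInv (youngConj Φ) (1 / M) ≤ nashTheta Φ ψ (ψ y / 256) := by
    have e1 := h_theta (ψ y) hψy.le
    have e2 := h_theta (ψ y / 16) (by positivity)
    rw [nashTheta_apply hψ_mono hy0, hy] at e1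
    rw [div_div] at e2
    norm_num at e2
    nlinarith
  have hev : ∀ᶠ k in atTop, ProbabilityTheory.variance (g k) μ *
      (lam ^ 2 * rInv (youngConj Φ) (1 / M)) ≤ C * ∫ x, ‖gradient (g k) x‖ ^ 2 ∂μ := by
    filter_upwards [h1.eventually_le_const (half_pos hη),
      -- The limiting variance is at least `a / 2`. Any fraction below `1/2` and at least `9/32 = 2
      -- · 36/256` would serve in the final comparison.
      h8.eventually_const_lt (show 1 / 3 * a < _ by linarith)] with k hk hkv
    refine le_trans ?_ (hN (g k) (h2 k) (h4 k) (h5 k))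
    refine mul_le_mul_of_nonneg_left (hθ.trans (nashTheta_mono hΦ hΨ hψ_top ?_))
      (ProbabilityTheory.variance_nonneg _ _)
    set V := ProbabilityTheory.variance (g k) μ with hV
    set u : EuclideanSpace ℝ (Fin n) → ℝ := fun x => g k x - ∫ y, g k y ∂μ with hu
    have hum : Measurable u := (h2 k).continuous.measurable.sub_const _
    have hgi : Integrable (g k) μ := (h4 k).integrable one_le_two
    have hmeanle : |∫ y, g k y ∂μ| ≤ |∫ x, h x ∂μ| + δ k := by
      have : |∫ y, g k y ∂μ - ∫ x, h x ∂μ| ≤ δ k := by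
        rw [← integral_sub hgi hi1, ← Real.norm_eq_abs]
        refine (norm_integral_le_of_norm_le (integrable_const (δ k))
          (.of_forall fun x => h3 k x)).trans ?_
        simp
      have h9 := abs_sub_abs_le_abs_sub (∫ y, g k y ∂μ) (∫ x, h x ∂μ)
      linarith
    -- One `c₀` each for `h`, for its mean, and for the uniform approximation error.
    have hubd : LuxLe (quotSq ψ) μ u (c₀ + c₀ + c₀) := by
      have hmabs : LuxLe (quotSq ψ) μ (fun _ => |∫ x, h x ∂μ|) c₀ := fun c hc => by
        refine le_of_eq_of_le ?_ (hmean c hc)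
        congr 1 with x
        rw [← hΨ.map_abs (|∫ x, h x ∂μ| / c), ← hΨ.map_abs ((∫ x, h x ∂μ) / c), abs_div, abs_abs,
          abs_div]
      have hadd := ((hluxabs.add hΨ hmabs hc0.le hc0.le hm.abs).add hΨ
        (hηc η (abs_of_pos hη).le) (by positivity) hc0.le (hm.abs.add_const _))
      refine hadd.of_abs_le hΨ.toIsYoungFunction (by positivity) fun x => ?_
      have e1 := abs_sub (g k x) (∫ y, g k y ∂μ)
      have e2 := abs_sub_abs_le_abs_sub (g k x) (h x)
      have e3 := h3 k x
      simp only [hu]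
      linarith
    have hle := hubd.luxNorm_le (by positivity)
    -- A zero norm would make the quotient inside `θ` equal to `0` by convention; it is excluded
    -- because it forces the variance to vanish.
    have hpos : 0 < luxNorm (quotSq ψ) μ u := by
      refine lt_of_le_of_ne LuxLe.luxNorm_nonneg fun h0 => ?_
      have hz := (hubd.of_luxNorm_le hΨ.toIsYoungFunction h0.symm.le).ae_eq_zero hΨ hum
      have hV0 : V = 0 := by
        rw [hV, ProbabilityTheory.variance_eq_integral (hgi.aemeasurable)]
        refine integral_eq_zero_of_ae ?_
        filter_upwards [hz] with x hx
        simp only [hu, Pi.zero_apply] at hx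
        simp [hx]
      linarith
    have hsqle : luxNorm (quotSq ψ) μ u ^ 2 ≤ 36 * a / ψ y := by
      have e1 := pow_le_pow_left₀ hpos.le hle 2
      have e2 : (c₀ + c₀ + c₀) ^ 2 = 36 * a / ψ y := by
        have : (c₀ + c₀ + c₀) ^ 2 = 9 * (4 * (√a) ^ 2 / s ^ 2) := by rw [hc₀]; ring
        rw [this, hsy, Real.sq_sqrt ha.le]; ring
      rwa [e2] at e1
    have hl2 : 0 < luxNorm (quotSq ψ) μ u ^ 2 := by positivity
    rw [← mul_div_assoc, le_div_iff₀ hl2]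
    calc ψ y / 256 * luxNorm (quotSq ψ) μ u ^ 2 ≤ ψ y / 256 * (36 * a / ψ y) := by gcongr
      _ = 36 / 256 * a := by field_simp
      _ ≤ 1 / 2 * V := by linarith
  have hfin := le_of_tendsto_of_tendsto (h8.mul_const _) (h6.const_mul C) hev
  refine le_trans ?_ hfin
  exact mul_le_mul_of_nonneg_right hvar
    (mul_nonneg (sq_nonneg _) (hΦ.conjInv_pos (one_div_pos.2 hM)).le)

end Approx

/-! ### Cutoffs and the extension to bounded locally Lipschitz functions -/

lemma LocallyLipschitz.mul_real {E : Type*} [PseudoEMetricSpace E] {f g : E → ℝ}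
    (hf : LocallyLipschitz f) (hg : LocallyLipschitz g) : LocallyLipschitz fun x => f x * g x :=
  (contDiff_mul (𝕜 := ℝ) (𝔸 := ℝ) (n := 1)).locallyLipschitz.comp (hf.prodMk hg)

/-- Compactness gives a constant on the ball of radius `ρ + 1`. A point outside it is at distance at
least `1` from any point where `h` may be nonzero, so the bound `B` also serves as a Lipschitz
constant there. -/
lemma LocallyLipschitz.exists_lipschitzWith {E : Type*} [NormedAddCommGroup E] [ProperSpace E]
    {h : E → ℝ} (hh : LocallyLipschitz h) {ρ B : ℝ} (hB : ∀ x, |h x| ≤ B)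
    (hs : ∀ x, ρ < ‖x‖ → h x = 0) : ∃ L : NNReal, LipschitzWith L h := by
  obtain ⟨K, hK⟩ := (hh.locallyLipschitzOn (s := Metric.closedBall (0 : E) (ρ + 1))
    ).exists_lipschitzOnWith_of_compact (isCompact_closedBall _ _)
  have hB0 : 0 ≤ B := (abs_nonneg _).trans (hB 0)
  have hout : ∀ x y, ρ + 1 < ‖y‖ → dist (h x) (h y) ≤ max K B.toNNReal * dist x y := by
    intro x y hy
    rw [hs y (by linarith)]
    by_cases hx : ρ < ‖x‖
    · rw [hs x hx, dist_self]; positivity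
    · have h1 : 1 ≤ dist x y := by
        rw [dist_eq_norm, norm_sub_rev]
        linarith [norm_sub_norm_le y x]
      rw [dist_zero_right, Real.norm_eq_abs]
      have h2 : B ≤ max K B.toNNReal := by
        rw [NNReal.coe_max, Real.coe_toNNReal _ hB0]; exact le_max_right _ _
      nlinarith [hB x]
  refine ⟨max K B.toNNReal, LipschitzWith.of_dist_le_mul fun x y => ?_⟩
  by_cases hy : ρ + 1 < ‖y‖
  · exact hout x y hy
  by_cases hx : ρ + 1 < ‖x‖
  · rw [dist_comm, dist_comm x]; exact hout y x hx
  · refine (hK.dist_le_mul x (by simpa using hx) y (by simpa using hy)).trans ?_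
    gcongr
    exact le_max_left _ _

section Cutoff

variable {n : ℕ} {μ : Measure (EuclideanSpace ℝ (Fin n))} [IsProbabilityMeasure μ]
  {u : EuclideanSpace ℝ (Fin n) → ℝ}

/-- Approximation of a bounded locally Lipschitz function by compactly supported ones. -/
lemma exists_lipschitz_sobolev_approx {B : ℝ} (hu : LocallyLipschitz u) (hB : ∀ x, |u x| ≤ B)
    (hd : ∀ᵐ x ∂μ, DifferentiableAt ℝ u x) (hi : Integrable (fun x => ‖fderiv ℝ u x‖ ^ 2) μ) :
    ∃ h : ℕ → EuclideanSpace ℝ (Fin n) → ℝ, (∀ k, ∃ L : NNReal, LipschitzWith L (h k)) ∧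
      (∀ k x, |h k x| ≤ |u x|) ∧ (∀ k, ∀ᵐ x ∂μ, DifferentiableAt ℝ (h k) x) ∧
      Tendsto (fun k => ∫ x, h k x ^ 2 ∂μ) atTop (𝓝 (∫ x, u x ^ 2 ∂μ)) ∧
      Tendsto (fun k => ∫ x, ‖fderiv ℝ (h k) x‖ ^ 2 ∂μ) atTop (𝓝 (∫ x, ‖fderiv ℝ u x‖ ^ 2 ∂μ)) := by
  let b : ContDiffBump (0 : EuclideanSpace ℝ (Fin n)) := ⟨1, 2, by norm_num, by norm_num⟩
  have hbs : ContDiff ℝ 1 b := b.contDiff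
  obtain ⟨K, hK⟩ := (hbs.continuous_fderiv one_ne_zero).norm.bddAbove_range_of_hasCompactSupport
    (b.hasCompactSupport.fderiv ℝ).norm
  have hK' : ∀ x, ‖fderiv ℝ b x‖ ≤ K := fun x => hK ⟨x, rfl⟩
  have hK0 : 0 ≤ K := (norm_nonneg _).trans (hK' 0)
  set r : ℕ → ℝ := fun k => ((k : ℝ) + 1)⁻¹ with hr
  have hr0 : ∀ k, 0 < r k := fun k => by simp only [hr]; positivity
  have hr1 : ∀ k, r k ≤ 1 := fun k => inv_le_one_of_one_le₀ (by simp)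
  set χ : ℕ → EuclideanSpace ℝ (Fin n) → ℝ := fun k x => b (r k • x) with hχ
  have hχs : ∀ k, ContDiff ℝ 1 (χ k) := fun k => hbs.comp (contDiff_const_smul (r k))
  have hχ0 : ∀ k x, 0 ≤ χ k x := fun k x => b.nonneg
  have hχ1 : ∀ k x, χ k x ≤ 1 := fun k x => b.le_one
  have hχf : ∀ k x, ‖fderiv ℝ (χ k) x‖ ≤ K := fun k x => by
    have h1 := (hbs.differentiable one_ne_zero (r k • x)).hasFDerivAt
    have h2 : HasFDerivAt (fun t : EuclideanSpace ℝ (Fin n) => r k • t)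
        (r k • ContinuousLinearMap.id ℝ _) x := (hasFDerivAt_id x).const_smul (r k)
    have h3 : fderiv ℝ (χ k) x = r k • fderiv ℝ b (r k • x) := by
      refine (h1.comp x h2).fderiv.trans ?_
      ext v
      simp
    rw [h3, norm_smul, Real.norm_eq_abs, abs_of_pos (hr0 k)]
    exact (mul_le_of_le_one_left (norm_nonneg _) (hr1 k)).trans (hK' _)
  have hle : ∀ k x, |χ k x * u x| ≤ |u x| := fun k x => by
    rw [abs_mul, abs_of_nonneg (hχ0 k x)]
    exact mul_le_of_le_one_left (abs_nonneg _) (hχ1 k x)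
  -- Near each point the cutoff is eventually `1`, so values and derivatives are eventually equal to
  -- those of `u`, and dominated convergence applies.
  have hev : ∀ x, ∀ᶠ k in atTop, (fun y => χ k y * u y) =ᶠ[𝓝 x] u := by
    intro x
    filter_upwards [(tendsto_natCast_atTop_atTop (R := ℝ)).eventually_gt_atTop ‖x‖] with k hk
    filter_upwards [continuous_norm.continuousAt.eventually_lt_const hk] with y hy
    have : χ k y = 1 := by
      apply b.one_of_mem_closedBall
      rw [mem_closedBall_zero_iff, norm_smul, Real.norm_eq_abs, abs_of_pos (hr0 k)]
      change r k * ‖y‖ ≤ 1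
      rw [hr]
      simp only
      rw [inv_mul_eq_div, div_le_one (by positivity)]
      linarith
    rw [this, one_mul]
  have hll : ∀ k, LocallyLipschitz fun x => χ k x * u x := fun k =>
    (hχs k).locallyLipschitz.mul_real hu
  refine ⟨fun k x => χ k x * u x, fun k => ?_, hle, fun k => ?_, ?_, ?_⟩
  · refine (hll k).exists_lipschitzWith (ρ := 2 * ((k : ℝ) + 1))
      (fun x => (hle k x).trans (hB x)) fun x hx => ?_
    have : χ k x = 0 := by
      apply b.zero_of_le_dist
      rw [dist_zero_right, norm_smul, Real.norm_eq_abs, abs_of_pos (hr0 k)]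
      change 2 ≤ r k * ‖x‖
      rw [hr]
      simp only
      rw [inv_mul_eq_div, le_div_iff₀ (by positivity)]
      exact hx.le
    rw [this, zero_mul]
  · filter_upwards [hd] with x hx
    exact ((hχs k).differentiable one_ne_zero x).mul hx
  · refine tendsto_integral_of_dominated_convergence (fun _ => B ^ 2)
      (fun k => ((hll k).continuous.pow 2).aestronglyMeasurable) (integrable_const _)
      (fun k => .of_forall fun x => ?_) (.of_forall fun x => ?_)
    · rw [norm_pow, Real.norm_eq_abs]
      exact pow_le_pow_left₀ (abs_nonneg _) ((hle k x).trans (hB x)) 2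
    · refine tendsto_const_nhds.congr' ?_
      filter_upwards [hev x] with k hk
      have h0 : χ k x * u x = u x := hk.eq_of_nhds
      rw [h0]
  · refine tendsto_integral_of_dominated_convergence
      (fun x => 2 * ‖fderiv ℝ u x‖ ^ 2 + 2 * (B * K) ^ 2)
      (fun k => ((measurable_fderiv ℝ _).norm.pow_const 2).aestronglyMeasurable)
      ((hi.const_mul 2).add (integrable_const _)) (fun k => ?_) (.of_forall fun x => ?_)
    · filter_upwards [hd] with x hx
      rw [norm_pow, norm_norm]
      have h1 : ‖fderiv ℝ (fun x => χ k x * u x) x‖ ≤ ‖fderiv ℝ u x‖ + B * K := by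
        rw [fderiv_fun_mul ((hχs k).differentiable one_ne_zero x) hx]
        refine (norm_add_le _ _).trans (add_le_add ?_ ?_)
        · rw [norm_smul, Real.norm_eq_abs, abs_of_nonneg (hχ0 k x)]
          exact mul_le_of_le_one_left (norm_nonneg _) (hχ1 k x)
        · rw [norm_smul, Real.norm_eq_abs]
          exact mul_le_mul (hB x) (hχf k x) (norm_nonneg _) ((abs_nonneg _).trans (hB x))
      refine (pow_le_pow_left₀ (norm_nonneg _) h1 2).trans ?_
      nlinarith [sq_nonneg (‖fderiv ℝ u x‖ - B * K)]
    · refine tendsto_const_nhds.congr' ?_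
      filter_upwards [hev x] with k hk
      rw [hk.fderiv_eq]

lemma NashIneq.mul_energy_nonneg_of_locallyLipschitz {Φ ψ : ℝ → ℝ} {C : ℝ} (hN : NashIneq μ Φ ψ C)
    {B : ℝ} (hu : LocallyLipschitz u) (hB : ∀ x, |u x| ≤ B)
    (hd : ∀ᵐ x ∂μ, DifferentiableAt ℝ u x) (hi : Integrable (fun x => ‖fderiv ℝ u x‖ ^ 2) μ) :
    0 ≤ C * ∫ x, ‖fderiv ℝ u x‖ ^ 2 ∂μ := by
  obtain ⟨h, h1, h2, h3, -, h5⟩ := exists_lipschitz_sobolev_approx hu hB hd hi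
  refine ge_of_tendsto' (h5.const_mul C) fun k => ?_
  obtain ⟨L, hL⟩ := h1 k
  exact hN.mul_energy_nonneg hL (fun x => (h2 k x).trans (hB x)) (h3 k)

/-- A Faber–Krahn type inequality for bounded locally Lipschitz functions. -/
lemma NashIneq.faberKrahn {Φ ψ : ℝ → ℝ} {C lam : ℝ} (hN : NashIneq μ Φ ψ C)
    (hΦ : IsNFunction Φ) (hΨ : IsNFunction (quotSq ψ))
    (hψ_mono : StrictMonoOn ψ (Ici 0)) (hψ_zero : ψ 0 = 0) (hψ_top : Tendsto ψ atTop atTop)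
    (hlam : 0 < lam)
    (h_theta : ∀ x : ℝ, 0 ≤ x → lam * nashTheta Φ ψ x ≤ nashTheta Φ ψ (x / 16))
    {B M : ℝ} (hu : LocallyLipschitz u) (hB : ∀ x, |u x| ≤ B)
    (hd : ∀ᵐ x ∂μ, DifferentiableAt ℝ u x) (hi : Integrable (fun x => ‖fderiv ℝ u x‖ ^ 2) μ)
    (hM : 0 < M) (hM2 : M ≤ 1 / 2) (hA : μ.real {x | u x ≠ 0} ≤ M) :
    1 / 2 * (∫ x, u x ^ 2 ∂μ) * (lam ^ 2 * rInv (youngConj Φ) (1 / M)) ≤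
      C * ∫ x, ‖fderiv ℝ u x‖ ^ 2 ∂μ := by
  obtain ⟨h, h1, h2, h3, h4, h5⟩ := exists_lipschitz_sobolev_approx hu hB hd hi
  refine le_of_tendsto_of_tendsto' ((h4.const_mul (1 / 2)).mul_const _) (h5.const_mul C) fun k => ?_
  obtain ⟨L, hL⟩ := h1 k
  refine hN.faberKrahn_of_lipschitz hΦ hΨ hψ_mono hψ_zero hψ_top hlam h_theta hL
    (fun x => (h2 k x).trans (hB x)) (h3 k) hM hM2 (le_trans (measureReal_mono fun x hx => ?_) hA)
  intro h0
  have := h2 k x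
  rw [h0, abs_zero] at this
  exact hx (abs_nonpos_iff.1 this)

end Cutoff

/-! ### A continuously differentiable truncation profile -/

/-- The density of the `C¹` truncation profile. -/
def stepDensity (t : ℝ) : ℝ := max 0 (6 * t * (1 - t))

/-- A `C¹` function equal to `0` on `(-∞, 0]` and to `1` on `[1, ∞)`, with slope at most `3 / 2`. -/
noncomputable def smoothStep (s : ℝ) : ℝ := ∫ t in (0 : ℝ)..s, stepDensity t

lemma continuous_stepDensity : Continuous stepDensity := by
  unfold stepDensity; fun_prop

lemma stepDensity_nonneg (t : ℝ) : 0 ≤ stepDensity t := le_max_left _ _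

lemma stepDensity_le (t : ℝ) : stepDensity t ≤ 3 / 2 :=
  max_le (by norm_num) (by nlinarith [sq_nonneg (2 * t - 1)])

lemma stepDensity_of_nonpos {t : ℝ} (ht : t ≤ 0) : stepDensity t = 0 :=
  max_eq_left (by nlinarith)

lemma stepDensity_of_one_le {t : ℝ} (ht : 1 ≤ t) : stepDensity t = 0 :=
  max_eq_left (by nlinarith)

lemma hasDerivAt_smoothStep (s : ℝ) : HasDerivAt smoothStep (stepDensity s) s :=
  intervalIntegral.integral_hasDerivAt_right (continuous_stepDensity.intervalIntegrable _ _)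
    (continuous_stepDensity.stronglyMeasurableAtFilter _ _) continuous_stepDensity.continuousAt

lemma smoothStep_of_nonpos {s : ℝ} (hs : s ≤ 0) : smoothStep s = 0 := by
  rw [smoothStep, intervalIntegral.integral_congr (g := fun _ => (0 : ℝ)), intervalIntegral.integral_zero]
  intro t ht
  rw [uIcc_of_ge hs] at ht
  exact stepDensity_of_nonpos ht.2

lemma smoothStep_one : smoothStep 1 = 1 := by
  rw [smoothStep, intervalIntegral.integral_congr (g := fun t : ℝ => 6 * t - 6 * t ^ 2)]
  · rw [intervalIntegral.integral_sub (by apply Continuous.intervalIntegrable; fun_prop)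
      (by apply Continuous.intervalIntegrable; fun_prop)]
    rw [intervalIntegral.integral_const_mul, intervalIntegral.integral_const_mul, integral_id,
      integral_pow]
    norm_num
  · intro t ht
    rw [uIcc_of_le zero_le_one] at ht
    simp only [stepDensity]
    rw [max_eq_right (by nlinarith [ht.1, ht.2])]
    ring

lemma smoothStep_of_one_le {s : ℝ} (hs : 1 ≤ s) : smoothStep s = 1 := by
  have h := intervalIntegral.integral_add_adjacent_intervals
    (continuous_stepDensity.intervalIntegrable (μ := volume) 0 1)
    (continuous_stepDensity.intervalIntegrable (μ := volume) 1 s)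
  have h0 : ∫ t in (1 : ℝ)..s, stepDensity t = 0 := by
    rw [intervalIntegral.integral_congr (g := fun _ => (0 : ℝ)), intervalIntegral.integral_zero]
    intro t ht
    rw [uIcc_of_le hs] at ht
    exact stepDensity_of_one_le ht.1
  rw [h0, add_zero] at h
  rw [smoothStep, ← h]
  exact smoothStep_one

lemma monotone_smoothStep : Monotone smoothStep :=
  monotone_of_deriv_nonneg (fun s => (hasDerivAt_smoothStep s).differentiableAt) fun s => by
    rw [(hasDerivAt_smoothStep s).deriv]; exact stepDensity_nonneg s

lemma abs_smoothStep_le (s : ℝ) : |smoothStep s| ≤ 1 := by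
  have h0 : 0 ≤ smoothStep s := by
    rcases le_total s 0 with h | h
    · exact (smoothStep_of_nonpos h).ge
    · rw [← smoothStep_of_nonpos le_rfl]; exact monotone_smoothStep h
  rw [abs_of_nonneg h0]
  rcases le_total s 1 with h | h
  · rw [← smoothStep_one]; exact monotone_smoothStep h
  · exact (smoothStep_of_one_le h).le

lemma contDiff_smoothStep : ContDiff ℝ 1 smoothStep := by
  rw [contDiff_one_iff_deriv]
  refine ⟨fun s => (hasDerivAt_smoothStep s).differentiableAt, ?_⟩
  have : deriv smoothStep = stepDensity := funext fun s => (hasDerivAt_smoothStep s).deriv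
  rw [this]; exact continuous_stepDensity

/-! ### Contracting recursions and geometric levels -/

/-- Summing and absorbing leaves the factor `1 / (1 - 9/16) = 16/7`. Only finite partial sums occur,
so no convergence is needed. -/
lemma sum_le_of_recursive_le {a b : ℕ → ℝ} (ha : ∀ j, 0 ≤ a j)
    (h : ∀ j, a (j + 1) ≤ b j + 9 / 16 * a j) (N : ℕ) :
    ∑ j ∈ Finset.range N, a j ≤ 16 / 7 * (a 0 + ∑ j ∈ Finset.range N, b j) := by
  have h1 : ∑ j ∈ Finset.range (N + 1), a j ≤
      a 0 + ∑ j ∈ Finset.range N, b j + 9 / 16 * ∑ j ∈ Finset.range N, a j := by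
    rw [Finset.sum_range_succ', Finset.mul_sum, add_comm, add_assoc, ← Finset.sum_add_distrib]
    gcongr with j
    exact h j
  rw [Finset.sum_range_succ] at h1
  linarith [ha N]

/-- Geometric levels. -/
noncomputable def geomLevel (ε : ℝ) (j : ℕ) : ℝ := ε * (3 / 2) ^ j

lemma geomLevel_pos {ε : ℝ} (hε : 0 < ε) (j : ℕ) : 0 < geomLevel ε j := by
  unfold geomLevel; positivity

lemma geomLevel_succ (ε : ℝ) (j : ℕ) : geomLevel ε (j + 1) = 3 / 2 * geomLevel ε j := by
  unfold geomLevel; ring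

lemma tendsto_geomLevel {ε : ℝ} (hε : 0 < ε) : Tendsto (geomLevel ε) atTop atTop :=
  (tendsto_pow_atTop_atTop_of_one_lt (by norm_num)).const_mul_atTop hε

/-- A discrete layer-cake formula: consecutive squared levels differ by `(9/4 - 1) t_j² = 5/4 t_j²`.
-/
lemma min_sq_le_sum_geomLevel {ε r : ℝ} (hε : 0 < ε) (hr : 0 ≤ r) (N : ℕ) :
    min r (geomLevel ε N) ^ 2 ≤ ε ^ 2 +
      ∑ j ∈ Finset.range N, 5 / 4 * geomLevel ε j ^ 2 * (if geomLevel ε j < r then 1 else 0) := by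
  induction N with
  | zero =>
    have : min r (geomLevel ε 0) ≤ ε := (min_le_right _ _).trans (by simp [geomLevel])
    simpa using pow_le_pow_left₀ (le_min hr (geomLevel_pos hε 0).le) this 2
  | succ N ih =>
    have h0 := geomLevel_pos hε N
    rw [Finset.sum_range_succ]
    by_cases h : geomLevel ε N < r
    · rw [min_eq_right h.le] at ih
      have h1 : min r (geomLevel ε (N + 1)) ≤ 3 / 2 * geomLevel ε N :=
        (min_le_right _ _).trans (geomLevel_succ ε N).le
      have h2 := pow_le_pow_left₀ (le_min hr (geomLevel_pos hε (N + 1)).le) h1 2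
      rw [if_pos h]
      linarith
    · rw [not_lt] at h
      rw [min_eq_left h] at ih
      rw [geomLevel_succ, min_eq_left (by linarith), if_neg (not_lt.2 h)]
      linarith

/-! ### Energy and measure of level sets -/

section Levels

variable {n : ℕ} {μ : Measure (EuclideanSpace ℝ (Fin n))} [IsProbabilityMeasure μ]
  {v : EuclideanSpace ℝ (Fin n) → ℝ}

/-- The Faber–Krahn inequality applied to the part of `v` between the levels `t` and `t + d`. -/
lemma NashIneq.level_energy_ge {Φ ψ : ℝ → ℝ} {C lam : ℝ} (hN : NashIneq μ Φ ψ C) (hC : 0 ≤ C)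
    (hΦ : IsNFunction Φ) (hΨ : IsNFunction (quotSq ψ))
    (hψ_mono : StrictMonoOn ψ (Ici 0)) (hψ_zero : ψ 0 = 0) (hψ_top : Tendsto ψ atTop atTop)
    (hlam : 0 < lam)
    (h_theta : ∀ x : ℝ, 0 ≤ x → lam * nashTheta Φ ψ x ≤ nashTheta Φ ψ (x / 16))
    (hv : LocallyLipschitz v) (hd : ∀ᵐ x ∂μ, DifferentiableAt ℝ v x)
    (hi : Integrable (fun x => ‖fderiv ℝ v x‖ ^ 2) μ) {t d : ℝ} (hd0 : 0 < d)
    (hM : 0 < μ.real {x | t < v x}) (hM2 : μ.real {x | t < v x} ≤ 1 / 2) :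
    1 / 2 * (d ^ 2 * μ.real {x | t + d < v x}) *
        (lam ^ 2 * rInv (youngConj Φ) (1 / μ.real {x | t < v x})) ≤
      9 / 4 * C * (∫ x in {x | t < v x}, ‖fderiv ℝ v x‖ ^ 2 ∂μ -
        ∫ x in {x | t + d < v x}, ‖fderiv ℝ v x‖ ^ 2 ∂μ) := by
  have hvm : Measurable v := hv.continuous.measurable
  have hA : ∀ a : ℝ, MeasurableSet {x | a < v x} := fun a => measurableSet_lt measurable_const hvm
  -- The profile is `C¹` because `u` must be differentiable wherever `v` is: `μ` may charge a level
  -- set at which a piecewise linear truncation has a kink. The price is slope `3/2`, hence the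
  -- factor `9/4`.
  set u : EuclideanSpace ℝ (Fin n) → ℝ := fun x => d * smoothStep ((v x - t) / d) with hu
  have hP : ContDiff ℝ 1 fun s : ℝ => d * smoothStep ((s - t) / d) :=
    contDiff_const.mul (contDiff_smoothStep.comp ((contDiff_id.sub contDiff_const).div_const d))
  have hul : LocallyLipschitz u := hP.locallyLipschitz.comp hv
  have hP' : ∀ s, HasDerivAt (fun s : ℝ => d * smoothStep ((s - t) / d))
      (stepDensity ((s - t) / d)) s := fun s => by
    have h1 := (hasDerivAt_smoothStep ((s - t) / d)).comp s
      (((hasDerivAt_id s).sub_const t).div_const d)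
    exact (h1.const_mul d).congr_deriv (by field_simp)
  have huB : ∀ x, |u x| ≤ d := fun x => by
    simp only [hu]
    rw [abs_mul, abs_of_pos hd0]
    exact mul_le_of_le_one_right hd0.le (abs_smoothStep_le _)
  have hfd : ∀ x, DifferentiableAt ℝ v x →
      HasFDerivAt u (stepDensity ((v x - t) / d) • fderiv ℝ v x) x := fun x hx =>
    (hP' (v x)).comp_hasFDerivAt x hx.hasFDerivAt
  set D : Set (EuclideanSpace ℝ (Fin n)) := {x | t < v x} \ {x | t + d < v x} with hD
  have hle : ∀ x, DifferentiableAt ℝ v x → ‖fderiv ℝ u x‖ ^ 2 ≤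
      D.indicator (fun x => 9 / 4 * ‖fderiv ℝ v x‖ ^ 2) x := by
    intro x hx
    rw [(hfd x hx).fderiv, norm_smul, mul_pow, Real.norm_eq_abs, sq_abs]
    by_cases hxD : x ∈ D
    · rw [indicator_of_mem hxD]
      gcongr
      have := pow_le_pow_left₀ (stepDensity_nonneg _) (stepDensity_le ((v x - t) / d)) 2
      linarith
    · rw [indicator_of_notMem hxD]
      have h0 : stepDensity ((v x - t) / d) = 0 := by
        by_cases h1 : t < v x
        · have h2 : t + d < v x := by
            by_contra h2
            exact hxD ⟨h1, h2⟩
          exact stepDensity_of_one_le (by rw [le_div_iff₀ hd0]; linarith)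
        · exact stepDensity_of_nonpos (div_nonpos_of_nonpos_of_nonneg (by linarith) hd0.le)
      rw [h0]; simp
  have hDm : MeasurableSet D := (hA t).diff (hA (t + d))
  have hgi : Integrable (D.indicator fun x => 9 / 4 * ‖fderiv ℝ v x‖ ^ 2) μ :=
    (hi.const_mul _).indicator hDm
  have hui : Integrable (fun x => ‖fderiv ℝ u x‖ ^ 2) μ := by
    refine hgi.mono' ((measurable_fderiv ℝ u).norm.pow_const 2).aestronglyMeasurable ?_
    filter_upwards [hd] with x hx
    rw [norm_pow, norm_norm]
    exact hle x hx
  have hsupp : μ.real {x | u x ≠ 0} ≤ μ.real {x | t < v x} := by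
    refine measureReal_mono fun x hx => ?_
    by_contra h
    have h' : v x ≤ t := not_lt.1 h
    refine hx ?_
    simp only [hu]
    rw [smoothStep_of_nonpos (div_nonpos_of_nonpos_of_nonneg (by linarith) hd0.le), mul_zero]
  have hFK := hN.faberKrahn hΦ hΨ hψ_mono hψ_zero hψ_top hlam h_theta hul huB
    (hd.mono fun x hx => (hfd x hx).differentiableAt) hui hM hM2 hsupp
  have hu2i : Integrable (fun x => u x ^ 2) μ := by
    refine Integrable.of_bound (hul.continuous.pow 2).aestronglyMeasurable (d ^ 2)
      (.of_forall fun x => ?_)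
    rw [norm_pow, Real.norm_eq_abs]
    exact pow_le_pow_left₀ (abs_nonneg _) (huB x) 2
  have hlow : d ^ 2 * μ.real {x | t + d < v x} ≤ ∫ x, u x ^ 2 ∂μ := by
    have h1 : ∫ x, {x | t + d < v x}.indicator (fun _ => d ^ 2) x ∂μ
        = d ^ 2 * μ.real {x | t + d < v x} := by
      rw [integral_indicator_const _ (hA _), smul_eq_mul, mul_comm]
    rw [← h1]
    refine integral_mono ((integrable_const _).indicator (hA _)) hu2i fun x => ?_
    refine indicator_le' (fun x hx => ?_) (fun x _ => sq_nonneg _) x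
    have hx' : t + d < v x := hx
    simp only [hu]
    rw [smoothStep_of_one_le (by rw [le_div_iff₀ hd0]; linarith), mul_one]
  have hup : ∫ x, ‖fderiv ℝ u x‖ ^ 2 ∂μ ≤ 9 / 4 * (∫ x in {x | t < v x}, ‖fderiv ℝ v x‖ ^ 2 ∂μ -
        ∫ x in {x | t + d < v x}, ‖fderiv ℝ v x‖ ^ 2 ∂μ) := by
    have hsub : {x | t + d < v x} ⊆ {x | t < v x} := fun x (hx : t + d < v x) =>
      show t < v x by linarith
    rw [← setIntegral_sdiff (hA _) hi.integrableOn hsub, ← integral_const_mul, ← integral_indicator hDm]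
    exact integral_mono_ae hui hgi (hd.mono hle)
  have hR := (hΦ.conjInv_pos (one_div_pos.2 hM)).le
  calc _ ≤ 1 / 2 * (∫ x, u x ^ 2 ∂μ) *
        (lam ^ 2 * rInv (youngConj Φ) (1 / μ.real {x | t < v x})) := by gcongr
    _ ≤ _ := hFK
    _ ≤ _ := by
      have := mul_le_mul_of_nonneg_left hup hC
      linarith

/-- The dichotomy between slow and fast decay of the measure of the level sets. -/
lemma IsNFunction.conjInv_level_le {Φ : ℝ → ℝ} (hΦ : IsNFunction Φ) {lam' : ℝ} (hlam' : 4 ≤ lam')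
    (h_conj : ∀ x : ℝ, 2 ≤ x →
      rInv (youngConj Φ) (lam' * x) ≤ lam' * rInv (youngConj Φ) x / 4)
    {M M' : ℝ} (hM : 0 < M) (hM2 : M ≤ 1 / 2) (hM' : 0 ≤ M') :
    M' * rInv (youngConj Φ) (1 / M') ≤
      lam' / 4 * (M' * rInv (youngConj Φ) (1 / M)) + 1 / 4 * (M * rInv (youngConj Φ) (1 / M)) := by
  have hR := hΦ.conjInv_pos (one_div_pos.2 hM)
  rcases eq_or_lt_of_le hM' with h0 | h0
  · rw [← h0, zero_mul, zero_mul]; positivity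
  have h2 : 2 ≤ 1 / M := by rw [le_div_iff₀ hM]; linarith
  have h3 := h_conj _ h2
  -- Slow decay: monotonicity and the growth hypothesis give the first term. Fast decay: `R(c x) ≤ c
  -- R(x)` with `c = M / (λ' M')`, followed by the growth hypothesis, gives the second.
  rcases le_total M (lam' * M') with h | h
  · have h4 : rInv (youngConj Φ) (1 / M') ≤ rInv (youngConj Φ) (lam' * (1 / M)) := by
      apply hΦ.conjInv_mono
      rw [mul_one_div, div_le_div_iff₀ h0 hM, one_mul]
      exact h
    have h5 := mul_le_mul_of_nonneg_left (h4.trans h3) hM'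
    have : 0 ≤ M * rInv (youngConj Φ) (1 / M) := by positivity
    linarith
  · have hc : 1 ≤ M / (lam' * M') := (one_le_div (by positivity)).2 h
    have h4 := hΦ.conjInv_mul_le hc (x := lam' * (1 / M))
    have h5 : M / (lam' * M') * (lam' * (1 / M)) = 1 / M' := by field_simp
    rw [h5] at h4
    have h6 : M' * (M / (lam' * M') * rInv (youngConj Φ) (lam' * (1 / M))) ≤
        M' * (M / (lam' * M') * (lam' * rInv (youngConj Φ) (1 / M) / 4)) := by gcongr
    have h7 : M' * (M / (lam' * M') * (lam' * rInv (youngConj Φ) (1 / M) / 4))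
        = 1 / 4 * (M * rInv (youngConj Φ) (1 / M)) := by field_simp
    have h8 := mul_le_mul_of_nonneg_left h4 hM'
    have : 0 ≤ lam' / 4 * (M' * rInv (youngConj Φ) (1 / M)) := by positivity
    linarith

/-- Faber–Krahn combined with the decay dichotomy gives a recursion for the summands. Its
contraction factor `9/16` is the growth `(3/2)²` of the squared levels times the gain `1/4`, and its
source terms are energy drops, which telescope. -/
lemma NashIneq.sum_levels_le {Φ ψ : ℝ → ℝ} {C lam lam' : ℝ} (hN : NashIneq μ Φ ψ C) (hC : 0 ≤ C)
    (hΦ : IsNFunction Φ) (hΨ : IsNFunction (quotSq ψ))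
    (hψ_mono : StrictMonoOn ψ (Ici 0)) (hψ_zero : ψ 0 = 0) (hψ_top : Tendsto ψ atTop atTop)
    (hlam : 0 < lam)
    (h_theta : ∀ x : ℝ, 0 ≤ x → lam * nashTheta Φ ψ x ≤ nashTheta Φ ψ (x / 16))
    (hlam' : 4 ≤ lam')
    (h_conj : ∀ x : ℝ, 2 ≤ x →
      rInv (youngConj Φ) (lam' * x) ≤ lam' * rInv (youngConj Φ) x / 4)
    (hv : LocallyLipschitz v) (hd : ∀ᵐ x ∂μ, DifferentiableAt ℝ v x)
    (hi : Integrable (fun x => ‖fderiv ℝ v x‖ ^ 2) μ) {ε : ℝ} (hε : 0 < ε)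
    (hM2 : μ.real {x | ε < v x} ≤ 1 / 2) (N : ℕ) :
    ∑ j ∈ Finset.range N, geomLevel ε j ^ 2 * (μ.real {x | geomLevel ε j < v x} *
        rInv (youngConj Φ) (1 / μ.real {x | geomLevel ε j < v x})) ≤
      16 / 7 * (ε ^ 2 * (rInv (youngConj Φ) 2 / 2) +
        81 / 8 * (lam' / lam ^ 2) * C * ∫ x in {x | 0 < v x}, ‖fderiv ℝ v x‖ ^ 2 ∂μ) := by
  set R := rInv (youngConj Φ) with hR
  set M : ℕ → ℝ := fun j => μ.real {x | geomLevel ε j < v x} with hMdef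
  set F : ℕ → ℝ := fun j => ∫ x in {x | geomLevel ε j < v x}, ‖fderiv ℝ v x‖ ^ 2 ∂μ with hF
  have hM0 : ∀ j, 0 ≤ M j := fun j => measureReal_nonneg
  have hRnn : ∀ x, 0 ≤ R x := fun x => rInv_nonneg _ _
  have ht := geomLevel_pos hε
  have hanti : ∀ j, {x | geomLevel ε (j + 1) < v x} ⊆ {x | geomLevel ε j < v x} :=
    fun j x (hx : _ < v x) => show _ < v x by
      rw [geomLevel_succ] at hx; linarith [ht j]
  have hMhalf : ∀ j, M j ≤ 1 / 2 := fun j => by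
    induction j with
    | zero => simpa [hMdef, geomLevel] using hM2
    | succ j ih => exact (measureReal_mono (hanti j)).trans ih
  have hFanti : ∀ j, F (j + 1) ≤ F j := fun j =>
    setIntegral_mono_set hi.integrableOn (.of_forall fun x => sq_nonneg _)
      (LE.le.eventuallyLE (hanti j))
  have hstep : ∀ j, geomLevel ε (j + 1) ^ 2 * (M (j + 1) * R (1 / M (j + 1))) ≤
      81 / 8 * (lam' / lam ^ 2) * C * (F j - F (j + 1)) +
        9 / 16 * (geomLevel ε j ^ 2 * (M j * R (1 / M j))) := by
    intro j
    rcases eq_or_lt_of_le (hM0 j) with h0 | h0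
    · have h1 : M (j + 1) = 0 :=
        le_antisymm ((measureReal_mono (hanti j)).trans h0.symm.le) (hM0 _)
      simp only [h1, ← h0, zero_mul, mul_zero, add_zero]
      have := sub_nonneg.2 (hFanti j)
      positivity
    · have h1 := hN.level_energy_ge hC hΦ hΨ hψ_mono hψ_zero hψ_top hlam h_theta hv hd hi
        (t := geomLevel ε j) (d := geomLevel ε j / 2) (half_pos (ht j)) h0 (hMhalf j)
      have h2 : geomLevel ε j + geomLevel ε j / 2 = geomLevel ε (j + 1) := by
        rw [geomLevel_succ]; ring
      rw [h2] at h1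
      change 1 / 2 * ((geomLevel ε j / 2) ^ 2 * M (j + 1)) * (lam ^ 2 * R (1 / M j)) ≤
        9 / 4 * C * (F j - F (j + 1)) at h1
      have h3 := hΦ.conjInv_level_le hlam' h_conj h0 (hMhalf j) (hM0 (j + 1))
      rw [geomLevel_succ]
      have h4 := mul_le_mul_of_nonneg_left h3 (sq_nonneg (3 / 2 * geomLevel ε j))
      -- Here `d` is half the level, so the slice inequality reads `t_j² M_{j+1} R(1/M_j) ≤ 18 C λ⁻²
      -- (F_j - F_{j+1})`, and `9/16 · 18 = 81/8`.
      have h5 : 9 / 16 * lam' * (geomLevel ε j ^ 2 * M (j + 1) * R (1 / M j)) ≤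
          81 / 8 * (lam' / lam ^ 2) * C * (F j - F (j + 1)) := by
        have h6 := mul_le_mul_of_nonneg_left h1
          (show 0 ≤ 9 / 2 * (lam' / lam ^ 2) by positivity)
        refine le_of_eq_of_le ?_ (h6.trans_eq (by ring))
        field_simp
        ring
      refine h4.trans ?_
      rw [← hR]
      linarith
  have hsum := sum_le_of_recursive_le
    (a := fun j => geomLevel ε j ^ 2 * (M j * R (1 / M j)))
    (fun j => mul_nonneg (sq_nonneg _) (mul_nonneg (hM0 j) (hRnn _))) hstep N
  refine hsum.trans ?_
  have hzero : geomLevel ε 0 = ε := by simp [geomLevel]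
  have hfirst : M 0 * R (1 / M 0) ≤ R 2 / 2 := by
    rcases eq_or_lt_of_le (hM0 0) with h0 | h0
    · rw [← h0, zero_mul]; linarith [hRnn 2]
    · have hc : 1 ≤ 1 / (2 * M 0) := by
        rw [le_div_iff₀ (by positivity)]; linarith [hMhalf 0]
      have h1 := hΦ.conjInv_mul_le hc (x := 2)
      have h2 : 1 / (2 * M 0) * 2 = 1 / M 0 := by field_simp
      rw [h2] at h1
      refine (mul_le_mul_of_nonneg_left h1 h0.le).trans_eq ?_
      rw [← hR]
      field_simp
  rw [← Finset.mul_sum, Finset.sum_range_sub', hzero]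
  have hF0 : F 0 - F N ≤ ∫ x in {x | 0 < v x}, ‖fderiv ℝ v x‖ ^ 2 ∂μ := by
    have h1 : 0 ≤ F N := integral_nonneg fun x => sq_nonneg _
    have h2 : F 0 ≤ ∫ x in {x | 0 < v x}, ‖fderiv ℝ v x‖ ^ 2 ∂μ :=
      setIntegral_mono_set hi.integrableOn (.of_forall fun x => sq_nonneg _)
        (LE.le.eventuallyLE fun x (hx : _ < v x) => (ht 0).trans hx)
    linarith
  gcongr

end Levels

/-! ### Medians -/

lemma exists_median {X : Type*} [MeasurableSpace X] {μ : Measure X} [IsProbabilityMeasure μ]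
    {f : X → ℝ} (hf : Measurable f) :
    ∃ m : ℝ, ∀ ε, 0 < ε → μ.real {x | ε < f x - m} ≤ 1 / 2 ∧ μ.real {x | ε < -(f x - m)} ≤ 1 / 2 := by
  have hA : ∀ a : ℝ, MeasurableSet {x | a < f x} := fun a => measurableSet_lt measurable_const hf
  set S : Set ℝ := {t | μ.real {x | t < f x} ≤ 1 / 2} with hS
  have hanti : Antitone fun t : ℝ => {x | t < f x} := fun a b hab x hx => hab.trans_lt hx
  have htop : Tendsto (fun t : ℝ => μ {x | t < f x}) atTop (𝓝 0) := by
    have h := tendsto_measure_iInter_atTop (μ := μ) (fun t => (hA t).nullMeasurableSet) hanti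
      ⟨0, measure_ne_top _ _⟩
    have h0 : ⋂ t : ℝ, {x | t < f x} = ∅ := by
      ext x
      simp only [mem_iInter, mem_empty_iff_false, iff_false, not_forall]
      exact ⟨f x, fun h => lt_irrefl (f x) h⟩
    rwa [h0, measure_empty] at h
  have hbot : Tendsto (fun t : ℝ => μ {x | t < f x}) atBot (𝓝 1) := by
    have h := tendsto_measure_iUnion_atBot (μ := μ) hanti
    have h0 : ⋃ t : ℝ, {x | t < f x} = univ := by
      ext x
      simp only [mem_iUnion, mem_univ, iff_true]
      exact ⟨f x - 1, show f x - 1 < f x by linarith⟩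
    rwa [h0, measure_univ] at h
  have hne : S.Nonempty := by
    have h := (ENNReal.tendsto_toReal ENNReal.zero_ne_top).comp htop
    obtain ⟨t, ht⟩ := (h.eventually_le_const (show (0 : ENNReal).toReal < 1 / 2 by norm_num)).exists
    exact ⟨t, ht⟩
  have hbdd : BddBelow S := by
    have h := (ENNReal.tendsto_toReal ENNReal.one_ne_top).comp hbot
    obtain ⟨t, ht⟩ := eventually_atBot.1
      (h.eventually_const_lt (show 1 / 2 < (1 : ENNReal).toReal by norm_num))
    refine ⟨t, fun s hs => ?_⟩
    by_contra! hst
    exact absurd hs (not_le.2 (ht s hst.le))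
  refine ⟨sInf S, fun ε hε => ⟨?_, ?_⟩⟩
  · obtain ⟨t, ht, hlt⟩ := exists_lt_of_csInf_lt hne (lt_add_of_pos_right (sInf S) hε)
    refine le_trans (measureReal_mono fun x hx => ?_) ht
    have : ε < f x - sInf S := hx
    exact show t < f x by linarith
  · have hnot : sInf S - ε ∉ S := fun h => absurd (csInf_le hbdd h) (by linarith)
    have h1 : 1 / 2 < μ.real {x | sInf S - ε < f x} := not_le.1 hnot
    have h2 := probReal_compl_eq_one_sub (μ := μ) (hA (sInf S - ε))
    have h3 : μ.real {x | ε < -(f x - sInf S)} ≤ μ.real {x | sInf S - ε < f x}ᶜ := by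
      refine measureReal_mono fun x hx => ?_
      have : ε < -(f x - sInf S) := hx
      exact fun h' : sInf S - ε < f x => by linarith
    linarith

/-! ### The Orlicz–Sobolev inequality around a median, and the sign of the constant -/

section Sobolev

variable {n : ℕ} {μ : Measure (EuclideanSpace ℝ (Fin n))} [IsProbabilityMeasure μ]
  {f : EuclideanSpace ℝ (Fin n) → ℝ}

/-- The Orlicz–Sobolev inequality centered at an approximate median. -/
lemma NashIneq.luxLe_sq_sub_median {Φ ψ : ℝ → ℝ} {C lam lam' : ℝ} (hN : NashIneq μ Φ ψ C)
    (hC : 0 ≤ C) (hΦ : IsNFunction Φ) (hΨ : IsNFunction (quotSq ψ))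
    (hψ_mono : StrictMonoOn ψ (Ici 0)) (hψ_zero : ψ 0 = 0) (hψ_top : Tendsto ψ atTop atTop)
    (hlam : 0 < lam)
    (h_theta : ∀ x : ℝ, 0 ≤ x → lam * nashTheta Φ ψ x ≤ nashTheta Φ ψ (x / 16))
    (hlam' : 4 ≤ lam')
    (h_conj : ∀ x : ℝ, 2 ≤ x →
      rInv (youngConj Φ) (lam' * x) ≤ lam' * rInv (youngConj Φ) x / 4)
    (hf : LocallyLipschitz f) (hd : ∀ᵐ x ∂μ, DifferentiableAt ℝ f x)
    (hi : Integrable (fun x => ‖fderiv ℝ f x‖ ^ 2) μ) {m : ℝ}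
    (hm : ∀ ε, 0 < ε → μ.real {x | ε < f x - m} ≤ 1 / 2 ∧ μ.real {x | ε < -(f x - m)} ≤ 1 / 2) :
    LuxLe Φ μ (fun x => (f x - m) ^ 2)
      (32 * (lam' / lam ^ 2) * C * ∫ x, ‖fderiv ℝ f x‖ ^ 2 ∂μ) := by
  have hfm : Measurable f := hf.continuous.measurable
  set R := rInv (youngConj Φ) with hR
  have hRnn : ∀ x, 0 ≤ R x := fun x => rInv_nonneg _ _
  set v : Bool → EuclideanSpace ℝ (Fin n) → ℝ := fun i x => if i then f x - m else -(f x - m)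
    with hv
  have hvm : ∀ i, Measurable (v i) := fun i => by
    cases i
    · exact (hfm.sub_const m).neg
    · exact hfm.sub_const m
  have hvl : ∀ i, LocallyLipschitz (v i) := fun i => by
    have h1 : LocallyLipschitz fun x => f x - m :=
      (contDiff_id.sub contDiff_const : ContDiff ℝ 1 fun s : ℝ => s - m).locallyLipschitz.comp hf
    cases i
    · exact h1.neg
    · exact h1
  have hvd : ∀ i, ∀ᵐ x ∂μ, DifferentiableAt ℝ (v i) x := fun i => by
    filter_upwards [hd] with x hx
    cases i
    · exact (hx.sub_const m).neg
    · exact hx.sub_const m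
  have hvf : ∀ i x, ‖fderiv ℝ (v i) x‖ = ‖fderiv ℝ f x‖ := fun i x => by
    cases i
    · have : v false = fun x => -(f x - m) := rfl
      rw [this, fderiv_fun_neg, norm_neg, fderiv_sub_const]
    · have : v true = fun x => f x - m := rfl
      rw [this, fderiv_sub_const]
  have hvi : ∀ i, Integrable (fun x => ‖fderiv ℝ (v i) x‖ ^ 2) μ := fun i => by
    simp_rw [hvf i]; exact hi
  set E := ∫ x, ‖fderiv ℝ f x‖ ^ 2 ∂μ with hE
  have hE0 : 0 ≤ E := integral_nonneg fun x => sq_nonneg _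
  have hEsum : ∫ x in {x | 0 < v true x}, ‖fderiv ℝ f x‖ ^ 2 ∂μ +
      ∫ x in {x | 0 < v false x}, ‖fderiv ℝ f x‖ ^ 2 ∂μ ≤ E := by
    rw [← setIntegral_union ?_ (measurableSet_lt measurable_const (hvm false)) hi.integrableOn
      hi.integrableOn]
    · exact setIntegral_le_integral hi (.of_forall fun x => sq_nonneg _)
    · rw [Set.disjoint_left]
      intro x (h1 : 0 < f x - m) (h2 : 0 < -(f x - m))
      linarith
  set κ := lam' / lam ^ 2 with hκ
  have hκ0 : 0 ≤ κ := by positivity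
  -- Total coefficient of `ε²`: `R 1` is the norm bound for the constant `1`, and each sign
  -- contributes `5/4 · 16/7 · R 2 / 2`.
  set D := R 1 + 20 / 7 * R 2 with hD
  have hD0 : 0 ≤ D := by linarith [hRnn 1, hRnn 2]
  have hS0 : 0 ≤ 32 * κ * C * E := by positivity
  have key : ∀ ε, 0 < ε → LuxLe Φ μ (fun x => (f x - m) ^ 2) (32 * κ * C * E + ε ^ 2 * D) := by
    intro ε hε
    set t := geomLevel ε with ht
    have ht0 : ∀ j, 0 < t j := geomLevel_pos hε
    set A : Bool → ℕ → Set (EuclideanSpace ℝ (Fin n)) := fun i j => {x | t j < v i x} with hA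
    have hAm : ∀ i j, MeasurableSet (A i j) := fun i j => measurableSet_lt measurable_const (hvm i)
    set a : Bool → ℕ → ℝ := fun i j => t j ^ 2 * (μ.real (A i j) * R (1 / μ.real (A i j))) with ha
    have ha0 : ∀ i j, 0 ≤ a i j := fun i j =>
      mul_nonneg (sq_nonneg _) (mul_nonneg measureReal_nonneg (hRnn _))
    have hsum : ∀ i N, ∑ j ∈ Finset.range N, a i j ≤ 16 / 7 * (ε ^ 2 * (R 2 / 2) +
        81 / 8 * κ * C * ∫ x in {x | 0 < v i x}, ‖fderiv ℝ f x‖ ^ 2 ∂μ) := fun i N => by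
      have := hN.sum_levels_le hC hΦ hΨ hψ_mono hψ_zero hψ_top hlam h_theta hlam' h_conj
        (hvl i) (hvd i) (hvi i) hε (by cases i; exacts [(hm ε hε).2, (hm ε hε).1]) N
      simp_rw [hvf i] at this
      exact this
    have hlev : ∀ i j, LuxLe Φ μ (fun x => 5 / 4 * t j ^ 2 * (A i j).indicator 1 x)
        (5 / 4 * a i j) := fun i j => by
      have := (LuxLe.indicator (μ := μ) hΦ (hAm i j)).const_mul
        (show 0 < 5 / 4 * t j ^ 2 by have := ht0 j; positivity)
      rwa [mul_assoc (5 / 4 : ℝ)] at this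
    have hlevm : ∀ i j, Measurable fun x => 5 / 4 * t j ^ 2 * (A i j).indicator (1 : EuclideanSpace ℝ (Fin n) → ℝ) x :=
      fun i j => (measurable_one.indicator (hAm i j)).const_mul _
    have hbase : LuxLe Φ μ (fun _ => ε ^ 2) (ε ^ 2 * R 1) := by
      have := (LuxLe.indicator (μ := μ) hΦ MeasurableSet.univ).const_mul
        (show 0 < ε ^ 2 by positivity)
      simpa using this
    set w : ℕ → EuclideanSpace ℝ (Fin n) → ℝ := fun N x => ε ^ 2 + ∑ j ∈ Finset.range N,
      (5 / 4 * t j ^ 2 * (A true j).indicator 1 x + 5 / 4 * t j ^ 2 * (A false j).indicator 1 x)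
      with hw
    have hwm : ∀ N, Measurable (w N) := fun N =>
      (Finset.measurable_sum _ fun j _ => (hlevm true j).add (hlevm false j)).const_add _
    have hwlux : ∀ N, LuxLe Φ μ (w N) (32 * κ * C * E + ε ^ 2 * D) := fun N => by
      have h1 := LuxLe.sum hΦ (μ := μ)
        (fun j => (hlev true j).add hΦ (hlev false j) (by linarith [ha0 true j])
          (by linarith [ha0 false j]) (hlevm true j))
        (fun j => by linarith [ha0 true j, ha0 false j])
        (fun j => (hlevm true j).add (hlevm false j)) N
      have h2 := hbase.add hΦ h1 (mul_nonneg (sq_nonneg _) (hRnn _))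
        (Finset.sum_nonneg fun j _ => by linarith [ha0 true j, ha0 false j]) measurable_const
      refine h2.mono ?_
      -- The energy coefficient is `5/4 · 16/7 · 81/8 = 405/14`, which is below `32`. The two signs
      -- share a single energy since they live on disjoint sets.
      rw [Finset.sum_add_distrib, ← Finset.mul_sum, ← Finset.mul_sum]
      have h3 := hsum true N
      have h4 := hsum false N
      have h5 := mul_le_mul_of_nonneg_left hEsum (show 0 ≤ κ * C by positivity)
      have h6 : 0 ≤ κ * C * E := by positivity
      rw [hD]
      linarith
    refine LuxLe.of_eventually hΦ hwlux (by positivity) hwm fun x => ?_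
    filter_upwards [(tendsto_geomLevel hε).eventually_ge_atTop |f x - m|] with N hN'
    have h1 := min_sq_le_sum_geomLevel hε (abs_nonneg (f x - m)) N
    rw [min_eq_left hN', sq_abs] at h1
    rw [abs_of_nonneg (sq_nonneg _)]
    refine h1.trans ?_
    simp only [hw]
    gcongr with j
    rw [← mul_add]
    have := ht0 j
    refine mul_le_mul_of_nonneg_left ?_ (by positivity)
    have hi0 : ∀ i, 0 ≤ (A i j).indicator (1 : EuclideanSpace ℝ (Fin n) → ℝ) x := fun i =>
      indicator_nonneg (fun _ _ => zero_le_one) x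
    split_ifs with hlt
    · rcases abs_choice (f x - m) with h | h
      · have hx : x ∈ A true j := show t j < f x - m by rw [← h]; exact hlt
        rw [indicator_of_mem hx]
        exact le_add_of_nonneg_right (hi0 false)
      · have hx : x ∈ A false j := show t j < -(f x - m) by rw [← h]; exact hlt
        rw [indicator_of_mem hx]
        exact le_add_of_nonneg_left (hi0 true)
    · exact add_nonneg (hi0 _) (hi0 _)
  refine LuxLe.of_forall_add fun δ hδ => ?_
  refine (key √(δ / (D + 1)) (Real.sqrt_pos.2 (by positivity))).mono ?_
  rw [Real.sq_sqrt (by positivity)]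
  have : δ / (D + 1) * D ≤ δ := by
    rw [div_mul_eq_mul_div, div_le_iff₀ (by linarith)]
    nlinarith
  linarith

/-- Replacing a negative constant in the Nash inequality by a nonnegative one. -/
lemma NashIneq.exists_nonneg {Φ ψ : ℝ → ℝ} {C : ℝ} (hN : NashIneq μ Φ ψ C)
    (hf : LocallyLipschitz f) (hd : ∀ᵐ x ∂μ, DifferentiableAt ℝ f x)
    (hi : Integrable (fun x => ‖fderiv ℝ f x‖ ^ 2) μ) :
    ∃ C', 0 ≤ C' ∧ NashIneq μ Φ ψ C' ∧
      C' * ∫ x, ‖fderiv ℝ f x‖ ^ 2 ∂μ = C * ∫ x, ‖fderiv ℝ f x‖ ^ 2 ∂μ := by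
  rcases le_or_gt 0 C with hC | hC
  · exact ⟨C, hC, hN, rfl⟩
  -- If `C < 0`, the inequality for the bounded function `arctan ∘ f` forces its energy to vanish.
  -- Its derivative is a positive multiple of that of `f`, so the energy of `f` vanishes too and `C`
  -- may be replaced by `0`.
  refine ⟨0, le_rfl, fun g h1 h2 h3 => (hN g h1 h2 h3).trans ?_, ?_⟩
  · have : 0 ≤ ∫ x, ‖gradient g x‖ ^ 2 ∂μ := integral_nonneg fun x => sq_nonneg _
    nlinarith
  have hfd : ∀ x, DifferentiableAt ℝ f x →
      HasFDerivAt (fun y => Real.arctan (f y)) ((1 / (1 + f x ^ 2)) • fderiv ℝ f x) x := fun x hx =>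
    hx.hasFDerivAt.arctan
  have hgi : Integrable (fun x => ‖fderiv ℝ (fun y => Real.arctan (f y)) x‖ ^ 2) μ := by
    refine hi.mono' ((measurable_fderiv ℝ _).norm.pow_const 2).aestronglyMeasurable ?_
    filter_upwards [hd] with x hx
    rw [norm_pow, norm_norm, (hfd x hx).fderiv, norm_smul, Real.norm_eq_abs,
      abs_of_pos (by positivity)]
    refine pow_le_pow_left₀ (by positivity) (mul_le_of_le_one_left (norm_nonneg _) ?_) 2
    rw [div_le_one (by positivity)]
    nlinarith [sq_nonneg (f x)]
  have h0 := hN.mul_energy_nonneg_of_locallyLipschitz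
    ((Real.contDiff_arctan (n := 1)).locallyLipschitz.comp hf)
    (B := Real.pi / 2) (fun x => (abs_lt.2 ⟨Real.neg_pi_div_two_lt_arctan _,
      Real.arctan_lt_pi_div_two _⟩).le) (hd.mono fun x hx => (hfd x hx).differentiableAt) hgi
  change 0 ≤ C * ∫ x, ‖fderiv ℝ (fun y => Real.arctan (f y)) x‖ ^ 2 ∂μ at h0
  have h1 : ∫ x, ‖fderiv ℝ (fun y => Real.arctan (f y)) x‖ ^ 2 ∂μ = 0 :=
    le_antisymm (nonpos_of_mul_nonneg_right h0 hC) (integral_nonneg fun x => sq_nonneg _)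
  rw [integral_eq_zero_iff_of_nonneg (fun x => sq_nonneg _) hgi] at h1
  have h2 : ∫ x, ‖fderiv ℝ f x‖ ^ 2 ∂μ = 0 := by
    refine integral_eq_zero_of_ae ?_
    filter_upwards [h1, hd] with x hx hx'
    rw [(hfd x hx').fderiv] at hx
    have h3 : (1 / (1 + f x ^ 2)) • fderiv ℝ f x = 0 := by simpa using hx
    have h4 : (1 / (1 + f x ^ 2)) ≠ 0 := by positivity
    rw [smul_eq_zero, or_iff_right h4] at h3
    simp [h3]
  rw [h2, mul_zero, mul_zero]

end Sobolev

/-! ### Passage from the median to the mean -/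

theorem mainTheorem11 (n : ℕ)
    (μ : Measure (EuclideanSpace ℝ (Fin n))) [IsProbabilityMeasure μ]
    (Φ ψ : ℝ → ℝ) (hΦ : IsNFunction Φ) (hΨ : IsNFunction (quotSq ψ))
    (hψ_mono : StrictMonoOn ψ (Ici 0)) (hψ_zero : ψ 0 = 0) (hψ_top : Tendsto ψ atTop atTop)
    (h_young : IsYoungFunction (fun x => quotSq ψ (rInv ψ (x ^ 2))))
    (lam : ℝ) (hlam : 0 < lam)
    (h_theta : ∀ x : ℝ, 0 ≤ x → lam * nashTheta Φ ψ x ≤ nashTheta Φ ψ (x / 16))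
    (lam' : ℝ) (hlam' : 4 ≤ lam')
    (h_conj : ∀ x : ℝ, 2 ≤ x →
      rInv (youngConj Φ) (lam' * x) ≤ lam' * rInv (youngConj Φ) x / 4)
    (C : ℝ)
    (h_nash : ∀ f : EuclideanSpace ℝ (Fin n) → ℝ, ContDiff ℝ ∞ f → MemLp f 2 μ →
      Integrable (fun x => ‖gradient f x‖ ^ 2) μ →
      ProbabilityTheory.variance f μ *
          nashTheta Φ ψ (1 / 2 * (ProbabilityTheory.variance f μ /
            luxNorm (quotSq ψ) μ (fun x => f x - ∫ y, f y ∂μ) ^ 2)) ≤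
        C * ∫ x, ‖gradient f x‖ ^ 2 ∂μ)
    (k : ℝ) (hk : 0 < k)
    (h_k : ∀ f : EuclideanSpace ℝ (Fin n) → ℝ, Measurable f →
      MemOrlicz Φ μ (fun x => f x ^ 2) →
      luxNorm Φ μ (fun _ => (∫ y, f y ∂μ) ^ 2) ≤ k * luxNorm Φ μ (fun x => f x ^ 2)) :
    ∀ f : EuclideanSpace ℝ (Fin n) → ℝ, LocallyLipschitz f →
      (∀ᵐ x ∂μ, DifferentiableAt ℝ f x) →
      Integrable (fun x => ‖gradient f x‖ ^ 2) μ →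
      Integrable f μ ∧
      MemOrlicz Φ μ (fun x => (f x - ∫ y, f y ∂μ) ^ 2) ∧
      luxNorm Φ μ (fun x => (f x - ∫ y, f y ∂μ) ^ 2) ≤
        64 * (1 + k) * lam' / lam ^ 2 * C * ∫ x, ‖gradient f x‖ ^ 2 ∂μ := by
  intro f hf hd hi
  simp_rw [norm_gradient_eq f] at hi ⊢
  have hN₀ : NashIneq μ Φ ψ C := h_nash
  obtain ⟨C', hC', hN, hCE⟩ := hN₀.exists_nonneg hf hd hi
  have hfm : Measurable f := hf.continuous.measurable
  obtain ⟨m, hm⟩ := exists_median (μ := μ) hfm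
  have hlux := hN.luxLe_sq_sub_median hC' hΦ hΨ hψ_mono hψ_zero hψ_top hlam h_theta hlam' h_conj
    hf hd hi hm
  set E := ∫ x, ‖fderiv ℝ f x‖ ^ 2 ∂μ with hE
  have hE0 : 0 ≤ E := integral_nonneg fun x => sq_nonneg _
  set S := 32 * (lam' / lam ^ 2) * C' * E with hS
  have hS0 : 0 ≤ S := by positivity
  have hsm : Measurable fun x => (f x - m) ^ 2 := (hfm.sub_const m).pow_const 2
  have hfi : Integrable f μ := by
    have h1 := hlux.integrable hΦ hS0 hsm
    have h2 : MemLp (fun x => f x - m) 2 μ :=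
      (memLp_two_iff_integrable_sq (hfm.sub_const m).aestronglyMeasurable).2 h1
    exact ((h2.integrable one_le_two).add (integrable_const m)).congr (.of_forall fun x => by simp)
  have hmean : ∫ y, (f y - m) ∂μ = ∫ y, f y ∂μ - m := by
    rw [integral_sub hfi (integrable_const m)]; simp
  have hconst : LuxLe Φ μ (fun _ => (∫ y, f y ∂μ - m) ^ 2) (k * S) := by
    have h1 := h_k (fun x => f x - m) (hfm.sub_const m) (hlux.memOrlicz hS0 hsm)
    rw [hmean] at h1
    obtain ⟨b, -, hb⟩ : ∃ b, 0 < b ∧ LuxLe Φ μ (fun _ => (∫ y, f y ∂μ - m) ^ 2) b := by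
      obtain ⟨η, hη, h⟩ := LuxLe.exists_const (μ := μ) hΦ one_pos
      set A := (∫ y, f y ∂μ - m) ^ 2 + 1 with hA
      have hA0 : 0 < A := by positivity
      have h2 := (h η (abs_of_pos hη).le).const_mul (div_pos hA0 hη)
      refine ⟨A / η * 1, by positivity, h2.of_abs_le hΦ.toIsYoungFunction (by positivity) fun _ => ?_⟩
      rw [div_mul_cancel₀ _ hη.ne', abs_of_nonneg (sq_nonneg _), hA]
      linarith
    exact LuxLe.of_luxNorm_le hΦ.toIsYoungFunction hb
      (h1.trans (mul_le_mul_of_nonneg_left (hlux.luxNorm_le hS0) hk.le))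
  -- From `(a - b)² ≤ 2a² + 2b²` with `a = f - m` and `b` its mean; the median bound `32` becomes
  -- `64 (1 + k)`.
  have hfin : LuxLe Φ μ (fun x => (f x - ∫ y, f y ∂μ) ^ 2) (2 * S + 2 * (k * S)) := by
    refine ((hlux.const_mul two_pos).add hΦ (hconst.const_mul two_pos) (by positivity)
      (by positivity) (hsm.const_mul 2)).of_abs_le hΦ.toIsYoungFunction (by positivity) fun x => ?_
    rw [abs_of_nonneg (sq_nonneg _)]
    nlinarith [sq_nonneg (f x - m + (∫ y, f y ∂μ - m))]
  refine ⟨hfi, hfin.memOrlicz (by positivity) ((hfm.sub_const _).pow_const 2),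
    (hfin.luxNorm_le (by positivity)).trans_eq ?_⟩
  rw [mul_assoc _ C E, ← hCE, hS]
  ring
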